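/- **Definitions.** Let $(X,d)$ be a metric space. For $n\in\mathbb N$ let $C_n^{uf}(X;\mathbb R)$ be the real vector space of bounded functions $c\colon X^{n+1}\to\mathbb R$ such that (with the maximum metric on $X^{n+1}$) for every $r>0$ there is $K_r$ with $|\{x\in B_r(y) : c(x)\ne 0\}|\le K_r$ for all $y\in X^{n+1}$, and there is $R_c>0$ such that $c(x)=0$ whenever $\sup_{i,j}d(x_i,x_j)>R_c$. Writing $c=\sum_x c(x)\cdot x$, let $\partial_n\colon C_n^{uf}(X;\mathbb R)\to C_{n-1}^{uf}(X;\mathbb R)$ $(n\ge 1)$ be given by $\partial_n(x)=\sum_{j=0}^n(-1)^j(x_0,\dots,\widehat{x_j},\dots,x_n)$. The homology of this chain complex is the uniformly finite homology $H_*^{uf}(X;\mathbb R)$. For a group $G$ with finite generating set $S$, the uniformly finite homological dimension is $$\mathrm{hd}_{uf}\,G=\sup\{n\in\mathbb N : H_n^{uf}(G;\mathbb R)\neq 0\},$$ where $G$ carries the word metric $d_S(g,h)=\min\{n : g^{-1}h=s_1\cdots s_n,\ s_i\in S\cup S^{-1}\}$ (and $\sup\emptyset=-\infty$, so that an equality $\mathrm{hd}_{uf}\,G=h\in\mathbb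 N$ includes $H_h^{uf}(G;\mathbb R)\ne 0$). The Hirsch rank of a finitely generated nilpotent group $N$ is $\sum_{i}\operatorname{rank}_{\mathbb Z}(\gamma_i(N)/\gamma_{i+1}(N))$, where $(\gamma_i(N))_i$ is the lower central series of $N$. The Hirsch rank of a finitely generated virtually nilpotent group is the Hirsch rank of any of its nilpotent subgroups of finite index. Two finitely generated groups $G,H$ are quasi-isometric if, for word metrics $d_G$, $d_H$ of some finite generating sets, there are a map $f\colon G\to H$ and constants $L\ge 1$, $C\ge 0$ with $L^{-1}d_G(x,x')-C\le d_H(f(x),f(x'))\le L\,d_G(x,x')+C$ for all $x,x'\in G$, such that every $y\in H$ satisfies $d_H(f(x),y)\le C$ for some $x\in G$. **Corollary 3.5.** Let $G$ be a finitely generated virtually nilpotent group. All nilpotent subgroups of finite index in $G$ have the same Hirsch rank, so that the Hirsch rank of $G$ is well defined, and for every finite generating set of $G$ the Hirsch rank of $G$ equals $\mathrm{hd}_{uf}\,G$. Consequently, the Hirsch rank is a quasi-isometry invariant: if $G$ and $H$ are quasi-isometric finitely generated virtually nilpotent groups, then they have the same Hirsch rank. -/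

import Mathlib

universe u v

noncomputable section

/-! ## Uniformly finite homology of a metric space -/

/-- The real vector space `C_n^uf(X; ℝ)` of uniformly finite `n`-chains of a metric space `X`.
The type `Fin (n + 1) → X` of `(n + 1)`-tuples carries the maximum metric. -/
def ufChains (X : Type u) [MetricSpace X] (n : ℕ) : Submodule ℝ ((Fin (n + 1) → X) → ℝ) where
  carrier := {c | (∃ M : ℝ, ∀ x, |c x| ≤ M) ∧
    (∀ r : ℝ, 0 < r → ∃ K : ℕ, ∀ y, {x | x ∈ Metric.ball y r ∧ c x ≠ 0}.encard ≤ K) ∧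
    (∃ R : ℝ, 0 < R ∧ ∀ x, (∃ i j, R < dist (x i) (x j)) → c x = 0)}
  zero_mem' := by
    refine ⟨⟨0, by simp⟩, fun r _ => ⟨0, by simp⟩, ⟨1, one_pos, by simp⟩⟩
  add_mem' := by
    rintro a b ⟨⟨M, hM⟩, ha, ⟨R, hR, hR'⟩⟩ ⟨⟨M', hM'⟩, hb, ⟨Q, hQ, hQ'⟩⟩
    refine ⟨⟨M + M', fun x => (abs_add_le _ _).trans (add_le_add (hM x) (hM' x))⟩,
      fun r hr => ?_, ⟨max R Q, lt_max_of_lt_left hR, ?_⟩⟩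
    · obtain ⟨K, hK⟩ := ha r hr
      obtain ⟨L, hL⟩ := hb r hr
      refine ⟨K + L, fun y => ?_⟩
      have hsub : {x | x ∈ Metric.ball y r ∧ (a + b) x ≠ 0} ⊆
          {x | x ∈ Metric.ball y r ∧ a x ≠ 0} ∪ {x | x ∈ Metric.ball y r ∧ b x ≠ 0} := by
        rintro x ⟨hx, hne⟩
        by_cases h : a x = 0
        · refine Or.inr ⟨hx, fun h' => hne ?_⟩
          simp [h, h']
        · exact Or.inl ⟨hx, h⟩
      calc _ ≤ _ := Set.encard_le_encard hsub
        _ ≤ _ := Set.encard_union_le _ _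
        _ ≤ _ := by push_cast; exact add_le_add (hK y) (hL y)
    · rintro x ⟨i, j, h⟩
      have h1 := hR' x ⟨i, j, (le_max_left _ _).trans_lt h⟩
      have h2 := hQ' x ⟨i, j, (le_max_right _ _).trans_lt h⟩
      simp [h1, h2]
  smul_mem' := by
    rintro t a ⟨⟨M, hM⟩, ha, ⟨R, hR, hR'⟩⟩
    refine ⟨⟨|t| * M, fun x => ?_⟩, fun r hr => ?_, ⟨R, hR, fun x hx => ?_⟩⟩
    · simp only [Pi.smul_apply, smul_eq_mul, abs_mul]
      exact mul_le_mul_of_nonneg_left (hM x) (abs_nonneg t)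
    · obtain ⟨K, hK⟩ := ha r hr
      refine ⟨K, fun y => (Set.encard_le_encard ?_).trans (hK y)⟩
      rintro x ⟨hx, hne⟩
      exact ⟨hx, fun h => hne (by simp [h])⟩
    · simp [hR' x hx]

section Boundary

variable {X : Type u} [MetricSpace X]

theorem ufChains_finite_fiber {n : ℕ} {c : (Fin (n + 2) → X) → ℝ} (hc : c ∈ ufChains X (n + 1)) :
    ∃ K : ℕ, ∀ (j : Fin (n + 2)) (y : Fin (n + 1) → X),
      {z : X | c (Fin.insertNth j z y) ≠ 0}.encard ≤ K := by
  obtain ⟨-, hb, R, hR, hR'⟩ := hc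
  obtain ⟨K, hK⟩ := hb (R + 1) (by linarith)
  refine ⟨K, fun j y => ?_⟩
  have hinj : Function.Injective (fun z : X => (Fin.insertNth j z y : Fin (n + 2) → X)) :=
    Fin.insertNth_left_injective (α := fun _ => X) y
  rw [← hinj.encard_image]
  refine (Set.encard_le_encard ?_).trans (hK (Fin.insertNth j (y 0) y))
  rintro _ ⟨z, hz, rfl⟩
  refine ⟨?_, hz⟩
  rw [Metric.mem_ball, dist_pi_lt_iff (by linarith)]
  intro k
  induction k using j.succAboveCases with
  | x =>
    simp only [Fin.insertNth_apply_same]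
    by_contra h
    refine hz (hR' _ ⟨j, j.succAbove 0, ?_⟩)
    simp only [Fin.insertNth_apply_same, Fin.insertNth_apply_succAbove]
    linarith
  | p k =>
    simp only [Fin.insertNth_apply_succAbove, dist_self]
    linarith

theorem ufChains_finite_fiber_two {n : ℕ} {c : (Fin (n + 3) → X) → ℝ}
    (hc : c ∈ ufChains X (n + 2)) (j : Fin (n + 3)) (i : Fin (n + 2)) (y : Fin (n + 1) → X) :
    {p : X × X | c (Fin.insertNth j p.2 (Fin.insertNth i p.1 y : Fin (n + 2) → X)) ≠ 0}.Finite := by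
  obtain ⟨-, hb, R, hR, hR'⟩ := hc
  obtain ⟨K, hK⟩ := hb (R + 1) (by linarith)
  have hinj : Function.Injective (fun p : X × X =>
      (Fin.insertNth j p.2 (Fin.insertNth i p.1 y : Fin (n + 2) → X) : Fin (n + 3) → X)) := by
    rintro ⟨a, b⟩ ⟨a', b'⟩ h
    obtain ⟨h1, h2⟩ := Fin.insertNth_inj (α := fun _ => X).1 h
    obtain ⟨h3, -⟩ := Fin.insertNth_inj (α := fun _ => X).1 h2
    exact Prod.ext h3 h1
  have key : (fun p : X × X =>
      (Fin.insertNth j p.2 (Fin.insertNth i p.1 y : Fin (n + 2) → X) : Fin (n + 3) → X)) ''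
      {p : X × X | c (Fin.insertNth j p.2 (Fin.insertNth i p.1 y : Fin (n + 2) → X)) ≠ 0} ⊆
      {x | x ∈ Metric.ball (Fin.insertNth j (y 0)
        (Fin.insertNth i (y 0) y : Fin (n + 2) → X) : Fin (n + 3) → X) (R + 1) ∧ c x ≠ 0} := by
    rintro _ ⟨⟨a, b⟩, hz, rfl⟩
    refine ⟨?_, hz⟩
    have hz' : ∀ k l, dist ((Fin.insertNth j b (Fin.insertNth i a y : Fin (n + 2) → X) :
        Fin (n + 3) → X) k) ((Fin.insertNth j b (Fin.insertNth i a y : Fin (n + 2) → X) :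
        Fin (n + 3) → X) l) ≤ R := by
      intro k l
      by_contra h
      exact hz (hR' _ ⟨k, l, not_le.1 h⟩)
    rw [Metric.mem_ball, dist_pi_lt_iff (by linarith)]
    intro k
    induction k using j.succAboveCases with
    | x =>
      have := hz' j (j.succAbove (i.succAbove 0))
      simp only [Fin.insertNth_apply_same, Fin.insertNth_apply_succAbove] at this ⊢
      linarith
    | p k =>
      simp only [Fin.insertNth_apply_succAbove]
      induction k using i.succAboveCases with
      | x =>
        have := hz' (j.succAbove i) (j.succAbove (i.succAbove 0))
        simp only [Fin.insertNth_apply_same, Fin.insertNth_apply_succAbove] at this ⊢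
        linarith
      | p k =>
        simp only [Fin.insertNth_apply_succAbove, dist_self]
        linarith
  refine Set.Finite.of_finite_image (Set.Finite.subset ?_ key) hinj.injOn
  exact Set.finite_of_encard_le_coe (hK _)

/-- The linear extension of `x ↦ (x₀, …, x̂ⱼ, …, x_{n+1})` to uniformly finite chains: the
coefficient of the result at `y` is the (finite) sum of the coefficients `c x` over all `x` whose
`j`-th face is `y`, that is, over all `x` which arise from `y` by inserting a point `z` at
position `j`. -/
def ufFace (n : ℕ) (j : Fin (n + 2)) : ufChains X (n + 1) →ₗ[ℝ] ufChains X n where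
  toFun c := ⟨fun y => ∑ᶠ z : X, c.1 (Fin.insertNth j z y), by
    obtain ⟨K, hK⟩ := ufChains_finite_fiber c.2
    obtain ⟨⟨M, hM⟩, hb, R, hR, hR'⟩ := c.2
    have hex : ∀ y : Fin (n + 1) → X, (∑ᶠ z : X, c.1 (Fin.insertNth j z y)) ≠ 0 →
        ∃ z : X, c.1 (Fin.insertNth j z y) ≠ 0 := by
      intro y hy
      by_contra! h
      exact hy (by simp [h])
    refine ⟨⟨K * M, fun y => ?_⟩, fun r hr => ?_, ⟨R, hR, ?_⟩⟩
    · have hfin : (Function.support fun z : X => c.1 (Fin.insertNth j z y)).Finite :=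
        Set.finite_of_encard_le_coe (hK j y)
      have hM0 : 0 ≤ M := (abs_nonneg _).trans (hM (fun _ => y 0))
      change |∑ᶠ z : X, c.1 (Fin.insertNth j z y)| ≤ K * M
      rw [finsum_eq_sum _ hfin]
      refine (Finset.abs_sum_le_sum_abs _ _).trans ?_
      refine (Finset.sum_le_card_nsmul _ _ M fun z _ => hM _).trans ?_
      rw [nsmul_eq_mul]
      refine mul_le_mul_of_nonneg_right ?_ hM0
      have h := hK j y
      change (Function.support fun z : X => c.1 (Fin.insertNth j z y)).encard ≤ K at h
      rw [hfin.encard_eq_coe_toFinset_card] at h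
      exact_mod_cast h
    · obtain ⟨L, hL⟩ := hb (R + r + 1) (by linarith)
      refine ⟨L, fun y₀ => ?_⟩
      refine le_trans (Set.encard_le_encard (t := (fun x : Fin (n + 2) → X => j.removeNth x) ''
        {x | x ∈ Metric.ball (Fin.insertNth j (y₀ 0) y₀ : Fin (n + 2) → X) (R + r + 1) ∧
          c.1 x ≠ 0}) ?_) ((Set.encard_image_le _ _).trans (hL _))
      rintro y ⟨hy, hne⟩
      obtain ⟨z, hz⟩ := hex y hne
      refine ⟨Fin.insertNth j z y, ⟨?_, hz⟩, by simp⟩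
      rw [Metric.mem_ball, dist_pi_lt_iff hr] at hy
      rw [Metric.mem_ball, dist_pi_lt_iff (by linarith)]
      intro k
      induction k using j.succAboveCases with
      | x =>
        simp only [Fin.insertNth_apply_same]
        have h1 : dist z (y 0) ≤ R := by
          by_contra h
          refine hz (hR' _ ⟨j, j.succAbove 0, ?_⟩)
          simp only [Fin.insertNth_apply_same, Fin.insertNth_apply_succAbove]
          linarith
        have h2 := dist_triangle z (y 0) (y₀ 0)
        have h3 := hy 0
        linarith
      | p k =>
        simp only [Fin.insertNth_apply_succAbove]
        have h3 := hy k
        linarith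
    · rintro y ⟨k, l, hkl⟩
      by_contra hne
      obtain ⟨z, hz⟩ := hex y hne
      refine hz (hR' _ ⟨j.succAbove k, j.succAbove l, ?_⟩)
      simpa only [Fin.insertNth_apply_succAbove] using hkl⟩
  map_add' a b := by
    obtain ⟨K, hK⟩ := ufChains_finite_fiber a.2
    obtain ⟨L, hL⟩ := ufChains_finite_fiber b.2
    ext y
    exact finsum_add_distrib (Set.finite_of_encard_le_coe (hK j y))
      (Set.finite_of_encard_le_coe (hL j y))
  map_smul' t a := by
    ext y
    exact (smul_finsum t _).symm

theorem ufFace_apply (n : ℕ) (j : Fin (n + 2)) (c : ufChains X (n + 1)) (y : Fin (n + 1) → X) :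
    (ufFace n j c).1 y = ∑ᶠ z : X, c.1 (Fin.insertNth j z y) := rfl

theorem ufFace_ufFace (n : ℕ) (i : Fin (n + 2)) (j : Fin (n + 3)) (c : ufChains X (n + 2)) :
    ufFace n i (ufFace (n + 1) j c) =
      ufFace n (i.predAbove j) (ufFace (n + 1) (j.succAbove i) c) := by
  ext y
  have h1 := ufChains_finite_fiber_two c.2 j i y
  have h2 := ufChains_finite_fiber_two c.2 (j.succAbove i) (i.predAbove j) y
  simp only [ufFace_apply]
  rw [← finsum_curry (fun p : X × X =>
      c.1 (Fin.insertNth j p.2 (Fin.insertNth i p.1 y : Fin (n + 2) → X))) h1,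
    ← finsum_curry (fun p : X × X => c.1 (Fin.insertNth (j.succAbove i) p.2
      (Fin.insertNth (i.predAbove j) p.1 y : Fin (n + 2) → X))) h2,
    ← finsum_comp_equiv (Equiv.prodComm X X)]
  refine finsum_congr fun p => ?_
  simp only [Equiv.prodComm_apply, Prod.fst_swap, Prod.snd_swap]
  refine congrArg c.1 (Eq.symm ?_)
  rw [Fin.insertNth_eq_iff (α := fun _ => X)]
  refine ⟨by simp, ?_⟩
  rw [Fin.insertNth_eq_iff (α := fun _ => X)]
  refine ⟨?_, ?_⟩
  · simp [Fin.removeNth, Fin.succAbove_succAbove_predAbove]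
  · rw [← Fin.removeNth_removeNth_eq_swap]
    simp

/-- The boundary operator `∂_{n+1} : C_{n+1}^uf(X; ℝ) → C_n^uf(X; ℝ)`. -/
def ufBoundary (X : Type u) [MetricSpace X] (n : ℕ) : ufChains X (n + 1) →ₗ[ℝ] ufChains X n :=
  ∑ j : Fin (n + 2), (-1 : ℝ) ^ (j : ℕ) • ufFace n j

theorem ufBoundary_comp (n : ℕ) : ufBoundary X n ∘ₗ ufBoundary X (n + 1) = 0 := by
  ext1 c
  simp only [ufBoundary, LinearMap.comp_apply, LinearMap.sum_apply, LinearMap.smul_apply, map_sum,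
    map_smul, LinearMap.zero_apply, Finset.smul_sum]
  rw [← Finset.sum_product', Finset.univ_product_univ]
  refine Finset.sum_involution
    (fun p _ => ((p.1.succAbove p.2 : Fin (n + 3)), (p.2.predAbove p.1 : Fin (n + 2)))) ?_ ?_ ?_ ?_
  · rintro ⟨j, i⟩ -
    have hs : (-1 : ℝ) ^ ((j.succAbove i : Fin (n + 3)) : ℕ) *
        (-1 : ℝ) ^ ((i.predAbove j : Fin (n + 2)) : ℕ) = -((-1) ^ (j : ℕ) * (-1) ^ (i : ℕ)) := by
      rw [← pow_add, ← pow_add, Fin.neg_one_pow_succAbove_add_predAbove]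
    dsimp only
    rw [ufFace_ufFace n i j c, smul_smul, smul_smul, ← add_smul]
    have h0 : (-1 : ℝ) ^ (i : ℕ) * (-1) ^ (j : ℕ) +
        (-1 : ℝ) ^ ((i.predAbove j : Fin (n + 2)) : ℕ) *
          (-1 : ℝ) ^ ((j.succAbove i : Fin (n + 3)) : ℕ) = 0 := by
      linarith [hs]
    first
      | rw [h0, zero_smul]
      | (rw [mul_comm ((-1 : ℝ) ^ (j : ℕ)), mul_comm ((-1 : ℝ) ^ ((j.succAbove i) : ℕ)), h0,
          zero_smul])
  · rintro ⟨j, i⟩ - - h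
    have := congrArg Prod.fst h
    exact Fin.succAbove_ne _ _ this
  · simp
  · rintro ⟨j, i⟩ -
    ext1 <;> simp [Fin.succAbove_succAbove_predAbove, Fin.predAbove_predAbove_succAbove]

end Boundary

/-- The uniformly finite chain complex `(C_n^uf(X; ℝ), ∂_n)`. -/
def ufComplex (X : Type u) [MetricSpace X] : ChainComplex (ModuleCat.{u} ℝ) ℕ :=
  ChainComplex.of (fun n => ModuleCat.of ℝ (ufChains X n))
    (fun n => ModuleCat.ofHom (ufBoundary X n))
    (fun n => by rw [← ModuleCat.ofHom_comp, ufBoundary_comp]; rfl)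

/-- The uniformly finite homology `H_n^uf(X; ℝ)`. -/
def ufHomology (X : Type u) [MetricSpace X] (n : ℕ) : ModuleCat.{u} ℝ :=
  (ufComplex X).homology n

/-- The uniformly finite homological dimension `sup {n ∈ ℕ | H_n^uf(X; ℝ) ≠ 0}`. It lies in
`ℕ ∪ {∞}` as soon as some `H_n^uf(X; ℝ)` is nonzero; if all of them vanish, it is the supremum of
the empty set, namely `⊥` (which is different from `0`). -/
def ufHomologicalDimension (X : Type u) [MetricSpace X] : WithBot ℕ∞ :=
  ⨆ (n : ℕ) (_ : Nontrivial (ufHomology X n)), ((n : ℕ∞) : WithBot ℕ∞)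

/-! ## Quasi-isometries and word metrics -/

/-- A map between metric spaces is a quasi-isometry if it is a quasi-isometric embedding with
coarsely dense image. -/
def IsQuasiIsometry {X : Type u} {Y : Type v} [MetricSpace X] [MetricSpace Y] (f : X → Y) : Prop :=
  ∃ L C : ℝ, 1 ≤ L ∧ 0 ≤ C ∧
    (∀ x x' : X, L⁻¹ * dist x x' - C ≤ dist (f x) (f x') ∧
      dist (f x) (f x') ≤ L * dist x x' + C) ∧
    ∀ y : Y, ∃ x : X, dist (f x) y ≤ C

section WordMetric

variable {G : Type u} [Group G]

/-- `d_S(g, h)`: the least length of a word in `S ∪ S⁻¹` representing `g⁻¹ h`. -/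
def wordDist (S : Set G) (g h : G) : ℕ :=
  sInf {n : ℕ | ∃ l : List G, l.length = n ∧ (∀ s ∈ l, s ∈ S ∨ s⁻¹ ∈ S) ∧ g⁻¹ * h = l.prod}

theorem exists_word (S : Set G) (hS : Subgroup.closure S = ⊤) (g h : G) :
    ∃ l : List G, l.length = wordDist S g h ∧ (∀ s ∈ l, s ∈ S ∨ s⁻¹ ∈ S) ∧ g⁻¹ * h = l.prod := by
  have hmem : g⁻¹ * h ∈ Subgroup.closure S := hS ▸ Subgroup.mem_top _
  rw [← Subgroup.mem_toSubmonoid, Subgroup.closure_toSubmonoid] at hmem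
  obtain ⟨l, hl, hp⟩ := Submonoid.exists_list_of_mem_closure hmem
  exact Nat.sInf_mem (s := {n : ℕ | ∃ l : List G, l.length = n ∧ (∀ s ∈ l, s ∈ S ∨ s⁻¹ ∈ S) ∧
    g⁻¹ * h = l.prod}) ⟨_, l, rfl, hl, hp.symm⟩

theorem wordDist_le (S : Set G) {g h : G} (l : List G) (hl : ∀ s ∈ l, s ∈ S ∨ s⁻¹ ∈ S)
    (hp : g⁻¹ * h = l.prod) : wordDist S g h ≤ l.length :=
  Nat.sInf_le ⟨l, rfl, hl, hp⟩

theorem wordDist_comm_le (S : Set G) (hS : Subgroup.closure S = ⊤) (g h : G) :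
    wordDist S g h ≤ wordDist S h g := by
  obtain ⟨l, hlen, hl, hp⟩ := exists_word S hS h g
  rw [← hlen]
  refine (wordDist_le S (l.map (·⁻¹)).reverse ?_ ?_).trans_eq (by simp)
  · intro s hs
    simp only [List.mem_reverse, List.mem_map] at hs
    obtain ⟨t, ht, rfl⟩ := hs
    simpa using (hl t ht).symm
  · rw [← List.prod_inv_reverse, ← hp]
    group

/-- The word metric on a group `G` with respect to a generating set `S`. -/
@[reducible] def wordMetric (S : Set G) (hS : Subgroup.closure S = ⊤) : MetricSpace G where
  dist g h := (wordDist S g h : ℝ)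
  dist_self g := by
    have := wordDist_le S (g := g) (h := g) [] (by simp) (by simp)
    exact_mod_cast Nat.le_zero.1 this
  dist_comm g h := by
    exact_mod_cast le_antisymm (wordDist_comm_le S hS g h) (wordDist_comm_le S hS h g)
  dist_triangle g h k := by
    obtain ⟨l, hlen, hl, hp⟩ := exists_word S hS g h
    obtain ⟨l', hlen', hl', hp'⟩ := exists_word S hS h k
    have : wordDist S g k ≤ (l ++ l').length := by
      refine wordDist_le S (l ++ l') ?_ ?_
      · intro s hs
        rcases List.mem_append.1 hs with h | h
        exacts [hl s h, hl' s h]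
      · rw [List.prod_append, ← hp, ← hp']
        group
    rw [List.length_append, hlen, hlen'] at this
    exact_mod_cast this
  eq_of_dist_eq_zero := by
    intro g h hgh
    obtain ⟨l, hlen, -, hp⟩ := exists_word S hS g h
    have h0 : l.length = 0 := by rw [hlen]; exact_mod_cast hgh
    rw [List.length_eq_zero_iff.1 h0, List.prod_nil] at hp
    exact inv_mul_eq_one.1 hp

/-- The uniformly finite homological dimension of a group `G` with generating set `S`, that is, of
`G` with the word metric with respect to `S`. -/
def groupUfHomologicalDimension (S : Set G) (hS : Subgroup.closure S = ⊤) : WithBot ℕ∞ :=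
  @ufHomologicalDimension G (wordMetric S hS)

/-- Two finitely generated groups are quasi-isometric if there is a quasi-isometry between them
with respect to word metrics of finite generating sets. -/
def GroupsQuasiIsometric (G : Type u) (H : Type v) [Group G] [Group H] : Prop :=
  ∃ (S : Set G) (hS : Subgroup.closure S = ⊤) (T : Set H) (hT : Subgroup.closure T = ⊤),
    S.Finite ∧ T.Finite ∧ ∃ f : G → H, @IsQuasiIsometry G H (wordMetric S hS) (wordMetric T hT) f

end WordMetric

/-! ## The Hirsch rank -/

section Hirsch

/-- The factor `γ_i(N) / γ_{i+1}(N)` of the lower central series `γ_0(N) = N`,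
`γ_{i+1}(N) = [γ_i(N), N]` of a group `N`. -/
abbrev LowerCentralFactor (N : Type u) [Group N] (i : ℕ) : Type u :=
  (Subgroup.lowerCentralSeries (⊤ : Subgroup N) i) ⧸
    (Subgroup.lowerCentralSeries (⊤ : Subgroup N) (i + 1)).subgroupOf
      (Subgroup.lowerCentralSeries (⊤ : Subgroup N) i)

instance lowerCentralFactorCommGroup (N : Type u) [Group N] (i : ℕ) :
    CommGroup (LowerCentralFactor N i) where
  mul_comm := by
    intro a b
    induction a using QuotientGroup.induction_on with | H a =>
    induction b using QuotientGroup.induction_on with | H b =>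
    rw [← QuotientGroup.mk_mul, ← QuotientGroup.mk_mul, QuotientGroup.eq, Subgroup.mem_subgroupOf]
    have h : (b : N)⁻¹ * (a : N)⁻¹ * (b : N)⁻¹⁻¹ * (a : N)⁻¹⁻¹ ∈
        Subgroup.lowerCentralSeries (⊤ : Subgroup N) (i + 1) :=
      Subgroup.commutator_mem_commutator (inv_mem b.2) (Subgroup.mem_top _)
    convert h using 1
    simp [mul_assoc]

/-- The Hirsch rank of a finitely generated nilpotent group `N`: the sum of the torsion-free ranks
of the (finitely generated abelian) factors of its lower central series. -/
def nilpotentHirschRank (N : Type u) [Group N] [Group.IsNilpotent N] : ℕ :=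
  ∑ i ∈ Finset.range (Group.nilpotencyClass N), Module.finrank ℤ (Additive (LowerCentralFactor N i))

open Classical in
/-- The Hirsch rank of a finitely generated virtually nilpotent group `G`: the Hirsch rank of a
nilpotent subgroup of finite index (and `0`, by convention, if `G` is not virtually nilpotent). -/
def hirschRank (G : Type u) [Group G] : ℕ :=
  if h : Group.IsVirtuallyNilpotent G then
    haveI : Group.IsNilpotent h.choose := h.choose_spec.1
    nilpotentHirschRank h.choose
  else 0

end Hirsch

end

/-! Uniformly finite homology is a quasi-isometry invariant: quasi-isometric embeddings push chains
forward, and a quasi-isometric embedding of a space into itself at bounded distance from the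
identity acts trivially on homology, by the prism operator. A nilpotent subgroup `N` of finite index
is quasi-isometric to `G`, so everything follows once hd_uf of a finitely generated nilpotent group
`N` is known to be its Hirsch rank. The dimension of `G` does not mention `N`, and the rank of `N`
does not mention the generating set, which gives well-definedness and invariance together.

Describing a tuple by its initial vertex and its successive quotients turns uniformly finite chains
into bar chains with coefficients in the bounded functions (`toUfChains`, `ufBoundary_toUfChains`),
so H_n^uf(N) = H_n(N; ℓ^∞(N)). With h the Hirsch rank, two facts suffice: H_n(N; A) = 0 for every
real representation A and n > h, and H_h(N; ℝ) ≠ 0. The vanishing in degree h + 1 makes H_h(N; -)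
left exact, so the constants ℝ ⊆ ℓ^∞(N) already give H_h(N; ℓ^∞(N)) ≠ 0 (`barMap_not_boundary`); no
invariant mean is needed.

Both facts are proved by climbing from 1 to N through normal subgroups K, refining the lower central
series, with successive quotients cyclic and central in N / K. In place of the homology of K with
coefficients in M one uses H_*(N; M ⊗ ℝ[N/K]), in the spirit of Shapiro's lemma, so that the group
never changes (`KerHasDimension`). If the next quotient is generated by t of infinite order, the
exact sequence 0 → M ⊗ ℝ[N/K] → M ⊗ ℝ[N/K] → M ⊗ ℝ[N/K'] → 0 with first map 1 - t raises the
dimension by one (`KerHasDimension.succ`). If t has finite order, averaging leaves it unchanged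
(`KerHasDimension.of_finite`). The infinite steps are counted by the ranks of the lower central
factors. The translation invariance of the top class has to be carried along, because it is what
makes 1 - t kill that class. -/

noncomputable section

/-! ### Nonzero homology in terms of cycles and boundaries -/

section Homology

variable {X : Type u} [MetricSpace X]

/-- The cycles of the uniformly finite chain complex. -/
def IsUfCycle : ∀ n, ufChains X n → Prop
  | 0, _ => True
  | n + 1, c => ufBoundary X n c = 0

theorem nontrivial_ufHomology_iff (n : ℕ) : Nontrivial (ufHomology X n) ↔
    ∃ c : ufChains X n, IsUfCycle n c ∧ c ∉ LinearMap.range (ufBoundary X n) := by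
  have hd : ∀ n, (ufComplex X).d (n + 1) n = ModuleCat.ofHom (ufBoundary X n) :=
    fun n => ChainComplex.of_d (fun n => ModuleCat.of ℝ (ufChains X n))
      (fun n => ModuleCat.ofHom (ufBoundary X n)) n
  -- The neighbouring degrees are variables, so that degree 0 is included: there the next degree is
  -- 0 itself and the outgoing differential is zero.
  have key : ∀ (n i j : ℕ), (ComplexShape.down ℕ).prev j = n → (ComplexShape.down ℕ).next j = i →
      ((ufComplex X).ExactAt j ↔ ∀ c : (ufComplex X).X j, (ufComplex X).d j i c = 0 →
        ∃ b, (ufComplex X).d n j b = c) := fun n i j h h' => by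
    rw [HomologicalComplex.exactAt_iff' _ n j i h h',
      CategoryTheory.ShortComplex.moduleCat_exact_iff]
    rfl
  rw [← not_subsingleton_iff_nontrivial, ← ModuleCat.isZero_iff_subsingleton]
  unfold ufHomology
  rw [← HomologicalComplex.exactAt_iff_isZero_homology, not_iff_comm]
  push Not
  cases n with
  | zero =>
    rw [key 1 0 0 (by simp) (by simp), hd 0, HomologicalComplex.shape _ 0 0 (by simp)]
    exact ⟨fun h c _ => h c trivial, fun h c _ => h c rfl⟩
  | succ n =>
    rw [key (n + 2) n (n + 1) (by simp) (by simp), hd (n + 1), hd n]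
    exact Iff.rfl

end Homology

/-! ### Push-forward of infinite chains -/

section Push

/-- The push-forward of a coefficient function along a map with finite fibres on its support. -/
def push {A B : Type*} (p : A → B) (c : A → ℝ) (y : B) : ℝ := ∑ᶠ (x) (_ : p x = y), c x

open Classical in
theorem push_eq {A B : Type*} (p : A → B) (c : A → ℝ) (y : B) :
    push p c y = ∑ᶠ x, if p x = y then c x else 0 :=
  finsum_congr fun x => by rw [finsum_eq_if]

/-- Fubini: both sides are iterated sums of one finitely supported function on `B × A`, concentrated
on the graph of `p`. -/
theorem push_push {A B C : Type*} (p : A → B) (q : B → C) (c : A → ℝ) (z : C)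
    (hfin : {x | q (p x) = z ∧ c x ≠ 0}.Finite) :
    push q (push p c) z = push (fun x => q (p x)) c z := by
  classical
  set F : B × A → ℝ := fun yx => if p yx.2 = yx.1 ∧ q yx.1 = z then c yx.2 else 0 with hF
  have hsupp : (Function.support F).Finite := by
    refine (hfin.image (fun x => (p x, x))).subset ?_
    rintro ⟨y, x⟩ h
    simp only [hF, Function.mem_support, ne_eq, ite_eq_right_iff, not_forall] at h
    obtain ⟨⟨h1, h2⟩, h3⟩ := h
    exact ⟨x, ⟨by rw [h1, h2], h3⟩, Prod.ext h1 rfl⟩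
  have h1 := finsum_curry F hsupp
  have h2 := finsum_curry (fun xy : A × B => F xy.swap)
    (hsupp.preimage (Prod.swap_injective.injOn))
  rw [show (∑ᶠ ab : A × B, F ab.swap) = ∑ᶠ ab, F ab from
    finsum_comp_equiv (Equiv.prodComm A B) (f := F), h1] at h2
  rw [push_eq, push_eq]
  convert h2 using 3 with y x
  · rw [push_eq]
    split_ifs with h
    · simp [hF, h]
    · simp [hF, h]
  · rw [finsum_eq_single _ (p x)]
    · simp [hF]
    · intro y hy
      simp [hF, Ne.symm hy]

theorem push_add {A B : Type*} (p : A → B) (c c' : A → ℝ) (y : B)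
    (h : {x | p x = y ∧ c x ≠ 0}.Finite) (h' : {x | p x = y ∧ c' x ≠ 0}.Finite) :
    push p (c + c') y = push p c y + push p c' y := by
  classical
  rw [push_eq, push_eq, push_eq, ← finsum_add_distrib]
  · exact finsum_congr fun x => by split_ifs <;> simp
  · exact h.subset fun x hx => by simpa using hx
  · exact h'.subset fun x hx => by simpa using hx

theorem push_smul {A B : Type*} (p : A → B) (t : ℝ) (c : A → ℝ) (y : B) :
    push p (t • c) y = t * push p c y := by
  classical
  rw [push_eq, push_eq, ← smul_eq_mul, smul_finsum]
  exact finsum_congr fun x => by split_ifs <;> simp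

theorem push_id {A : Type*} (c : A → ℝ) (y : A) : push (fun x => x) c y = c y := by
  classical
  rw [push_eq, finsum_eq_single _ y]
  · simp
  · intro x hx
    simp [hx]

/-- A linear relation between maps, valid pointwise in the free module, yields the same relation
between push-forwards. -/
theorem sum_push_eq_zero {A B ι : Type*} [Fintype ι] (a : ι → ℝ) (p : ι → A → B) (c : A → ℝ)
    (hfin : ∀ i y, {x | p i x = y ∧ c x ≠ 0}.Finite)
    (h : ∀ x, ∑ i, a i • Finsupp.single (p i x) (1 : ℝ) = 0) (y : B) :
    ∑ i, a i * push (p i) c y = 0 := by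
  classical
  have h1 : ∀ i, a i * push (p i) c y = ∑ᶠ x, c x * (a i • Finsupp.single (p i x) (1 : ℝ)) y := by
    intro i
    rw [push_eq, ← smul_eq_mul, smul_finsum]
    refine finsum_congr fun x => ?_
    simp only [Finsupp.smul_apply, Finsupp.single_apply]
    split_ifs <;> simp [mul_comm]
  simp_rw [h1]
  rw [← finsum_sum_comm]
  · rw [finsum_eq_zero_of_forall_eq_zero]
    intro x
    rw [← Finset.mul_sum, ← Finsupp.finsetSum_apply, h x]
    simp
  · intro i _
    refine (hfin i y).subset fun x hx => ?_
    simp only [Function.mem_support, Finsupp.smul_apply, Finsupp.single_apply] at hx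
    refine ⟨?_, fun h0 => hx (by simp [h0])⟩
    by_contra hne
    exact hx (by simp [hne])

end Push

/-! ### Maps of tuples that preserve uniformly finite chains -/

section Tame

variable {X : Type*} {Y : Type*} {Z : Type*} [MetricSpace X] [MetricSpace Y] [MetricSpace Z]

/-- Quasi-isometric embeddings. -/
def IsQuasiEmbedding (f : X → Y) : Prop :=
  ∃ L C : ℝ, 1 ≤ L ∧ 0 ≤ C ∧ ∀ x x' : X, L⁻¹ * dist x x' - C ≤ dist (f x) (f x') ∧
      dist (f x) (f x') ≤ L * dist x x' + C

theorem IsQuasiEmbedding.id : IsQuasiEmbedding (fun x : X => x) :=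
  ⟨1, 0, le_rfl, le_rfl, fun x x' => by simp⟩

theorem IsQuasiEmbedding.comp {g : Y → Z} {f : X → Y} (hg : IsQuasiEmbedding g)
    (hf : IsQuasiEmbedding f) : IsQuasiEmbedding (fun x => g (f x)) := by
  obtain ⟨L, C, hL, hC, h⟩ := hf
  obtain ⟨L', C', hL', hC', h'⟩ := hg
  have hLC : 0 ≤ L' * C := by positivity
  refine ⟨L * L', L' * C + C + C', by nlinarith, by linarith, fun x x' => ?_⟩
  obtain ⟨h1, h2⟩ := h x x'
  obtain ⟨h3, h4⟩ := h' (f x) (f x')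
  have hL'0 : 0 < L' := by linarith
  constructor
  · have h5 := mul_le_mul_of_nonneg_left h1 (inv_nonneg.2 hL'0.le)
    have h6 : L'⁻¹ * C ≤ C := by
      have : L'⁻¹ ≤ 1 := inv_le_one_of_one_le₀ hL'
      nlinarith
    rw [mul_inv]
    have h7 : L'⁻¹ * (L⁻¹ * dist x x' - C) = L⁻¹ * L'⁻¹ * dist x x' - L'⁻¹ * C := by ring
    linarith
  · have h5 := mul_le_mul_of_nonneg_left h2 hL'0.le
    nlinarith

/-- A map between tuples is tame if it stays at bounded distance of (the entries of) a
quasi-isometric embedding. -/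
def IsTame {n m : ℕ} (p : (Fin n → X) → (Fin m → Y)) : Prop :=
  ∃ f : X → Y, IsQuasiEmbedding f ∧ ∃ D : ℝ, 0 ≤ D ∧ ∀ x k, ∃ i, dist (p x k) (f (x i)) ≤ D

theorem IsTame.comp {n m l : ℕ} {q : (Fin m → Y) → (Fin l → Z)} {p : (Fin n → X) → (Fin m → Y)}
    (hq : IsTame q) (hp : IsTame p) : IsTame (fun x => q (p x)) := by
  obtain ⟨f, hf, D, hD, h⟩ := hp
  obtain ⟨g, hg, D', hD', h'⟩ := hq
  refine ⟨_, hg.comp hf, ?_⟩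
  obtain ⟨L, C, hL, hC, hg⟩ := hg
  refine ⟨D' + (L * D + C), by positivity, fun x k => ?_⟩
  obtain ⟨i, hi⟩ := h' (p x) k
  obtain ⟨j, hj⟩ := h x i
  refine ⟨j, (dist_triangle _ (g (p x i)) _).trans (add_le_add hi ?_)⟩
  exact (hg _ _).2.trans (by gcongr)

theorem IsQuasiEmbedding.isTame {f : X → Y} (hf : IsQuasiEmbedding f) (n : ℕ) :
    IsTame (fun (x : Fin n → X) k => f (x k)) :=
  ⟨f, hf, 0, le_rfl, fun x k => ⟨k, by simp⟩⟩

theorem isTame_id (n : ℕ) : IsTame (fun x : Fin n → X => x) :=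
  ⟨_, .id, 0, le_rfl, fun x k => ⟨k, by simp⟩⟩

theorem isTame_removeNth {n : ℕ} (j : Fin (n + 1)) :
    IsTame (fun x : Fin (n + 1) → X => j.removeNth x) :=
  ⟨_, .id, 0, le_rfl, fun x k => ⟨j.succAbove k, by simp [Fin.removeNth]⟩⟩

/-- Tame maps are uniformly proper on tuples of bounded diameter. Entries of `p x` and `p x'` shadow
images of vertices under a quasi-isometric embedding, whose lower bound brings two vertices
together; the diameter bound brings the others along. -/
theorem IsTame.exists_ball {n m : ℕ} {p : (Fin n → X) → (Fin (m + 1) → Y)} (hp : IsTame p)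
    (R r : ℝ) : ∃ ρ : ℝ, 0 < ρ ∧ ∀ y x x', (∀ i j, dist (x i) (x j) ≤ R) →
      (∀ i j, dist (x' i) (x' j) ≤ R) → p x ∈ Metric.ball y r → p x' ∈ Metric.ball y r →
      x' ∈ Metric.ball x ρ := by
  obtain ⟨f, ⟨L, C, hL, hC, hf⟩, D, hD, h⟩ := hp
  have hL0 : 0 < L := by linarith
  -- The images under `f` of two vertices are at distance at most `2 * D + 2 * |r|`; the lower bound
  -- then costs `C` and a factor `L`, passing to arbitrary vertices costs `2 * |R|`, and 1 makes the
  -- inequality strict.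
  refine ⟨L * (2 * D + 2 * |r| + C) + 2 * |R| + 1, by positivity, ?_⟩
  intro y x x' hx hx' hpx hpx'
  obtain ⟨i, hi⟩ := h x 0
  obtain ⟨i', hi'⟩ := h x' 0
  have h1 : dist (p x 0) (y 0) ≤ |r| :=
    (dist_le_pi_dist _ _ _).trans ((Metric.mem_ball.1 hpx).le.trans (le_abs_self r))
  have h2 : dist (p x' 0) (y 0) ≤ |r| :=
    (dist_le_pi_dist _ _ _).trans ((Metric.mem_ball.1 hpx').le.trans (le_abs_self r))
  have h3 : dist (f (x' i')) (f (x i)) ≤ 2 * D + 2 * |r| := by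
    have a1 := dist_triangle (f (x' i')) (p x' 0) (f (x i))
    have a2 := dist_triangle (p x' 0) (p x 0) (f (x i))
    have a3 := dist_triangle_right (p x' 0) (p x 0) (y 0)
    rw [dist_comm (f (x' i')) (p x' 0)] at a1
    linarith
  have h4 : dist (x' i') (x i) ≤ L * (2 * D + 2 * |r| + C) := by
    have := (hf (x' i') (x i)).1
    have h5 : L⁻¹ * dist (x' i') (x i) ≤ 2 * D + 2 * |r| + C := by linarith
    rwa [inv_mul_le_iff₀ hL0] at h5
  rw [Metric.mem_ball, dist_pi_lt_iff (by positivity)]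
  intro k
  have a1 := dist_triangle4 (x' k) (x' i') (x i) (x k)
  have a2 := hx i k
  have a3 := hx' k i'
  have a4 := le_abs_self R
  linarith

/-- If the set contains some `x`, it lies in a ball around `x` whose radius does not depend on `y`,
and there the local bound for `c` applies. -/
theorem IsTame.encard_le {n m : ℕ} {p : (Fin (n + 1) → X) → (Fin (m + 1) → Y)} (hp : IsTame p)
    {c : (Fin (n + 1) → X) → ℝ} (hc : c ∈ ufChains X n) (r : ℝ) :
    ∃ K : ℕ, ∀ y, {x | p x ∈ Metric.ball y r ∧ c x ≠ 0}.encard ≤ K := by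
  obtain ⟨-, hb, R, hR, hR'⟩ := hc
  have hdiam : ∀ x, c x ≠ 0 → ∀ i j, dist (x i) (x j) ≤ R := by
    intro x hx i j
    by_contra h
    exact hx (hR' x ⟨i, j, not_le.1 h⟩)
  obtain ⟨ρ, hρ, h⟩ := hp.exists_ball R r
  obtain ⟨K, hK⟩ := hb ρ hρ
  refine ⟨K, fun y => ?_⟩
  rcases Set.eq_empty_or_nonempty {x | p x ∈ Metric.ball y r ∧ c x ≠ 0} with h0 | ⟨x, hx, hcx⟩
  · rw [h0]
    simp
  · refine (Set.encard_le_encard ?_).trans (hK x)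
    rintro x' ⟨hx', hcx'⟩
    exact ⟨h y x x' (hdiam x hcx) (hdiam x' hcx') hx hx', hcx'⟩

theorem IsTame.exists_encard_fiber_le {n m : ℕ} {p : (Fin (n + 1) → X) → (Fin (m + 1) → Y)}
    (hp : IsTame p) {c : (Fin (n + 1) → X) → ℝ} (hc : c ∈ ufChains X n) :
    ∃ K : ℕ, ∀ y, {x | p x = y ∧ c x ≠ 0}.encard ≤ K := by
  obtain ⟨K, hK⟩ := hp.encard_le hc 1
  refine ⟨K, fun y => (Set.encard_le_encard ?_).trans (hK y)⟩
  rintro x ⟨rfl, hx⟩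
  exact ⟨by simp, hx⟩

theorem IsTame.finite_fiber {n m : ℕ} {p : (Fin (n + 1) → X) → (Fin (m + 1) → Y)}
    (hp : IsTame p) {c : (Fin (n + 1) → X) → ℝ} (hc : c ∈ ufChains X n) (y : Fin (m + 1) → Y) :
    {x | p x = y ∧ c x ≠ 0}.Finite := by
  obtain ⟨K, hK⟩ := hp.exists_encard_fiber_le hc
  exact Set.finite_of_encard_le_coe (hK y)

theorem exists_of_push_ne_zero {A B : Type*} {p : A → B} {c : A → ℝ} {y : B}
    (h : push p c y ≠ 0) : ∃ x, p x = y ∧ c x ≠ 0 := by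
  by_contra! h'
  refine h ?_
  rw [push_eq, finsum_eq_zero_of_forall_eq_zero]
  intro x
  split_ifs with hx
  exacts [h' x hx, rfl]

theorem IsTame.push_mem {n m : ℕ} {p : (Fin (n + 1) → X) → (Fin (m + 1) → Y)} (hp : IsTame p)
    {c : (Fin (n + 1) → X) → ℝ} (hc : c ∈ ufChains X n) : push p c ∈ ufChains Y m := by
  classical
  refine ⟨?_, fun r hr => ?_, ?_⟩
  · obtain ⟨K, hK⟩ := hp.exists_encard_fiber_le hc
    obtain ⟨M, hM⟩ := hc.1
    refine ⟨K * |M|, fun y => ?_⟩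
    have hfin := hp.finite_fiber hc y
    rw [push_eq, finsum_eq_finsetSum_of_support_subset (s := hfin.toFinset)]
    · refine (Finset.abs_sum_le_sum_abs _ _).trans ?_
      refine (Finset.sum_le_card_nsmul _ _ |M| fun x _ => ?_).trans ?_
      · split_ifs
        · exact (hM x).trans (le_abs_self M)
        · simp
      · rw [nsmul_eq_mul]
        refine mul_le_mul_of_nonneg_right ?_ (abs_nonneg M)
        have h := hK y
        rw [hfin.encard_eq_coe_toFinset_card] at h
        exact_mod_cast h
    · intro x hx
      simpa using hx
  · obtain ⟨K, hK⟩ := hp.encard_le hc r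
    refine ⟨K, fun y => le_trans (Set.encard_le_encard
      (t := p '' {x | p x ∈ Metric.ball y r ∧ c x ≠ 0}) ?_)
      ((Set.encard_image_le _ _).trans (hK y))⟩
    rintro z ⟨hz, hne⟩
    obtain ⟨x, rfl, hx⟩ := exists_of_push_ne_zero hne
    exact ⟨x, ⟨hz, hx⟩, rfl⟩
  · obtain ⟨-, -, R, hR, hR'⟩ := hc
    obtain ⟨f, ⟨L, C, hL, hC, hf⟩, D, hD, h⟩ := hp
    refine ⟨2 * D + (L * R + C), by positivity, ?_⟩
    rintro y ⟨k, l, hkl⟩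
    by_contra hne
    obtain ⟨x, rfl, hx⟩ := exists_of_push_ne_zero hne
    obtain ⟨i, hi⟩ := h x k
    obtain ⟨j, hj⟩ := h x l
    have h1 : dist (x i) (x j) ≤ R := by
      by_contra h
      exact hx (hR' x ⟨i, j, not_le.1 h⟩)
    have h2 : dist (f (x i)) (f (x j)) ≤ L * R + C := (hf _ _).2.trans (by gcongr)
    have a1 := dist_triangle4 (p x k) (f (x i)) (f (x j)) (p x l)
    rw [dist_comm (f (x j))] at a1
    linarith

/-- The map of uniformly finite chains induced by a tame map of tuples. -/
def IsTame.pushChain {n m : ℕ} {p : (Fin (n + 1) → X) → (Fin (m + 1) → Y)} (hp : IsTame p) :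
    ufChains X n →ₗ[ℝ] ufChains Y m where
  toFun c := ⟨push p c.1, hp.push_mem c.2⟩
  map_add' a b := by
    ext y
    exact push_add p _ _ y (hp.finite_fiber a.2 y) (hp.finite_fiber b.2 y)
  map_smul' t a := by
    ext y
    exact push_smul p t _ y

theorem IsTame.pushChain_apply {n m : ℕ} {p : (Fin (n + 1) → X) → (Fin (m + 1) → Y)}
    (hp : IsTame p) (c : ufChains X n) (y : Fin (m + 1) → Y) :
    (hp.pushChain c).1 y = push p c.1 y := rfl

theorem IsTame.pushChain_pushChain {n m l : ℕ} {p : (Fin (n + 1) → X) → (Fin (m + 1) → Y)}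
    {q : (Fin (m + 1) → Y) → (Fin (l + 1) → Z)} (hq : IsTame q) (hp : IsTame p)
    (c : ufChains X n) : hq.pushChain (hp.pushChain c) = (hq.comp hp).pushChain c := by
  ext z
  exact push_push p q c.1 z ((hq.comp hp).finite_fiber c.2 z)

/-- With faces written as push-forwards, identities between chain maps reduce to identities between
maps of tuples. -/
theorem ufFace_eq_pushChain (n : ℕ) (j : Fin (n + 2)) (c : ufChains X (n + 1)) :
    ufFace n j c = (isTame_removeNth j).pushChain c := by
  ext y
  rw [ufFace_apply, IsTame.pushChain_apply, push]
  have hinj : Function.Injective (fun z : X => (Fin.insertNth j z y : Fin (n + 2) → X)) :=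
    Fin.insertNth_left_injective (α := fun _ => X) y
  rw [← finsum_mem_range (f := c.1) hinj]
  refine finsum_congr fun x => finsum_congr_Prop (propext ⟨?_, ?_⟩) fun _ => rfl
  · rintro ⟨z, rfl⟩
    simp
  · rintro rfl
    exact ⟨x j, by simp⟩

end Tame

/-! ### The prism homotopy in free modules on tuples -/

section Prism

variable {X : Type*}

/-- The `i`-th piece `(x₀, …, xᵢ, φ xᵢ, …, φ xₙ)` of the prism over a tuple. -/
def prismMap (φ : X → X) {n : ℕ} (i : Fin n) (x : Fin n → X) (k : Fin (n + 1)) : X :=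
  if k ≤ i.castSucc then x (i.predAbove k) else φ (x (i.predAbove k))

theorem prismMap_zero (φ : X → X) {n : ℕ} (x : Fin (n + 1) → X) :
    prismMap φ 0 x = Fin.cons (x 0) (fun k => φ (x k)) := by
  ext k
  cases k using Fin.cases with
  | zero => simp [prismMap]
  | succ k => simp [prismMap]

theorem prismMap_succ (φ : X → X) {n : ℕ} (i : Fin n) (a : X) (l : Fin n → X) :
    prismMap φ i.succ (Fin.cons a l : Fin (n + 1) → X) = Fin.cons a (prismMap φ i l) := by
  ext k
  cases k using Fin.cases with
  | zero => simp [prismMap]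
  | succ k => simp [prismMap]

/-- The alternating sum of the faces in the free module on tuples. -/
def freeBoundary (X : Type*) (n : ℕ) : ((Fin (n + 1) → X) →₀ ℝ) →ₗ[ℝ] ((Fin n → X) →₀ ℝ) :=
  ∑ j : Fin (n + 1), (-1 : ℝ) ^ (j : ℕ) • Finsupp.lmapDomain ℝ ℝ (fun x => j.removeNth x)

/-- The prism operator in the free module on tuples. -/
def freePrism (φ : X → X) (n : ℕ) : ((Fin n → X) →₀ ℝ) →ₗ[ℝ] ((Fin (n + 1) → X) →₀ ℝ) :=
  ∑ i : Fin n, (-1 : ℝ) ^ (i : ℕ) • Finsupp.lmapDomain ℝ ℝ (prismMap φ i)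

/-- The cone operator in the free module on tuples. -/
def freeCone (a : X) (n : ℕ) : ((Fin n → X) →₀ ℝ) →ₗ[ℝ] ((Fin (n + 1) → X) →₀ ℝ) :=
  Finsupp.lmapDomain ℝ ℝ (fun l => (Fin.cons a l : Fin (n + 1) → X))

/-- The map induced on the free module on tuples. -/
def freeMap (φ : X → X) (n : ℕ) : ((Fin n → X) →₀ ℝ) →ₗ[ℝ] ((Fin n → X) →₀ ℝ) :=
  Finsupp.lmapDomain ℝ ℝ (fun l k => φ (l k))

theorem freeBoundary_single {n : ℕ} (x : Fin (n + 1) → X) (r : ℝ) :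
    freeBoundary X n (Finsupp.single x r) =
      ∑ j : Fin (n + 1), (-1 : ℝ) ^ (j : ℕ) • Finsupp.single (j.removeNth x) r := by
  simp only [freeBoundary, LinearMap.sum_apply, LinearMap.smul_apply, Finsupp.lmapDomain_apply,
    Finsupp.mapDomain_single]

theorem freePrism_single (φ : X → X) {n : ℕ} (x : Fin n → X) (r : ℝ) :
    freePrism φ n (Finsupp.single x r) =
      ∑ i : Fin n, (-1 : ℝ) ^ (i : ℕ) • Finsupp.single (prismMap φ i x) r := by
  simp only [freePrism, LinearMap.sum_apply, LinearMap.smul_apply, Finsupp.lmapDomain_apply,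
    Finsupp.mapDomain_single]

theorem freeCone_single (a : X) {n : ℕ} (x : Fin n → X) (r : ℝ) :
    freeCone a n (Finsupp.single x r) = Finsupp.single (Fin.cons a x : Fin (n + 1) → X) r := by
  simp only [freeCone, Finsupp.lmapDomain_apply, Finsupp.mapDomain_single]

theorem freeMap_single (φ : X → X) {n : ℕ} (x : Fin n → X) (r : ℝ) :
    freeMap φ n (Finsupp.single x r) = Finsupp.single (fun k => φ (x k)) r := by
  simp only [freeMap, Finsupp.lmapDomain_apply, Finsupp.mapDomain_single]

theorem freeBoundary_freeCone (a : X) (n : ℕ) (w : (Fin (n + 1) → X) →₀ ℝ) :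
    freeBoundary X (n + 1) (freeCone a (n + 1) w) = w - freeCone a n (freeBoundary X n w) := by
  induction w using Finsupp.induction_linear with
  | zero => simp
  | add f g hf hg => simp only [map_add, hf, hg]; abel
  | single l r =>
    have h : ∀ j : Fin (n + 1), j.succ.removeNth (Fin.cons a l : Fin (n + 2) → X) =
        (Fin.cons a (j.removeNth l) : Fin (n + 1) → X) := by
      intro j
      ext k
      cases k using Fin.cases <;> simp [Fin.removeNth]
    have h0 : (0 : Fin (n + 2)).removeNth (Fin.cons a l : Fin (n + 2) → X) = l := by
      ext k
      simp [Fin.removeNth]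
    simp only [freeCone_single, freeBoundary_single, map_sum, map_smul,
      Fin.sum_univ_succ (n := n + 1), h, h0, Fin.val_zero, pow_zero, one_smul, Fin.val_succ,
      pow_succ, mul_neg, mul_one, neg_smul, Finset.sum_neg_distrib, sub_eq_add_neg]

theorem freeBoundary_freeCone_zero (a : X) (w : (Fin 0 → X) →₀ ℝ) :
    freeBoundary X 0 (freeCone a 0 w) = w := by
  induction w using Finsupp.induction_linear with
  | zero => simp
  | add f g hf hg => simp only [map_add, hf, hg]
  | single l r =>
    simp [freeBoundary, freeCone, Finsupp.mapDomain_single, Subsingleton.elim _ l]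

theorem freePrism_freeCone (φ : X → X) (a : X) (n : ℕ) (w : (Fin n → X) →₀ ℝ) :
    freePrism φ (n + 1) (freeCone a n w) =
      freeCone a (n + 1) (freeCone (φ a) n (freeMap φ n w)) - freeCone a (n + 1) (freePrism φ n w) := by
  induction w using Finsupp.induction_linear with
  | zero => simp
  | add f g hf hg => simp only [map_add, hf, hg]; abel
  | single l r =>
    have h : (fun k => φ ((Fin.cons a l : Fin (n + 1) → X) k)) =
        (Fin.cons (φ a) (fun k => φ (l k)) : Fin (n + 1) → X) := by
      ext k
      cases k using Fin.cases <;> simp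
    simp only [freeCone_single, freePrism_single, freeMap_single, map_sum, map_smul,
      Fin.sum_univ_succ (n := n), prismMap_zero, prismMap_succ, h, Fin.cons_zero, Fin.val_zero,
      pow_zero, one_smul, Fin.val_succ, pow_succ, mul_neg, mul_one, neg_smul,
      Finset.sum_neg_distrib, sub_eq_add_neg]

theorem freeMap_freeBoundary (φ : X → X) (n : ℕ) (w : (Fin (n + 1) → X) →₀ ℝ) :
    freeMap φ n (freeBoundary X n w) = freeBoundary X n (freeMap φ (n + 1) w) := by
  simp only [freeMap, freeBoundary, LinearMap.sum_apply, LinearMap.smul_apply, map_sum, map_smul,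
    Finsupp.lmapDomain_apply, ← Finsupp.mapDomain_comp]
  rfl

theorem freeMap_freeCone (φ : X → X) (a : X) (n : ℕ) (w : (Fin n → X) →₀ ℝ) :
    freeMap φ (n + 1) (freeCone a n w) = freeCone (φ a) n (freeMap φ n w) := by
  simp only [freeMap, freeCone, Finsupp.lmapDomain_apply, ← Finsupp.mapDomain_comp]
  congr 1
  ext l k
  cases k using Fin.cases <;> simp

/-- A tuple is the cone from its first vertex over its tail. The boundary of a cone and the
recursion `freePrism_freeCone` reduce each degree to the one below, without rearranging double sums
of faces. The complex is augmented by the empty tuple, which supplies the base case. -/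
theorem freePrism_homotopy (φ : X → X) (n : ℕ) (w : (Fin (n + 1) → X) →₀ ℝ) :
    freeBoundary X (n + 1) (freePrism φ (n + 1) w) + freePrism φ n (freeBoundary X n w) =
      freeMap φ (n + 1) w - w := by
  induction n with
  | zero =>
    induction w using Finsupp.induction_linear with
    | zero => simp
    | add f g hf hg =>
      simp only [map_add]
      calc _ = _ := add_add_add_comm _ _ _ _
        _ = _ := by rw [hf, hg]; abel
    | single x r =>
      have hx : Finsupp.single x r = freeCone (x 0) 0 (Finsupp.single (Fin.tail x) r) := by
        simp only [freeCone, Finsupp.lmapDomain_apply, Finsupp.mapDomain_single]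
        congr 1
        exact (Fin.cons_self_tail x).symm
      have h0 : ∀ w, freePrism φ 0 w = 0 := by simp [freePrism]
      rw [hx, freePrism_freeCone, map_sub, freeBoundary_freeCone, freeBoundary_freeCone_zero, h0,
        h0, map_zero, map_zero, freeMap_freeCone]
      have h1 : ∀ w, freeMap φ 0 w = w := by
        intro w
        have : (fun (l : Fin 0 → X) k => φ (l k)) = id := by
          ext l k
          exact k.elim0
        rw [freeMap, this, Finsupp.lmapDomain_id]
        rfl
      rw [h1]
      abel
  | succ n ih =>
    induction w using Finsupp.induction_linear with
    | zero => simp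
    | add f g hf hg =>
      simp only [map_add]
      calc _ = _ := add_add_add_comm _ _ _ _
        _ = _ := by rw [hf, hg]; abel
    | single x r =>
      have hx : Finsupp.single x r =
          freeCone (x 0) (n + 1) (Finsupp.single (Fin.tail x) r) := by
        simp only [freeCone, Finsupp.lmapDomain_apply, Finsupp.mapDomain_single]
        congr 1
        exact (Fin.cons_self_tail x).symm
      rw [hx]
      generalize Finsupp.single (Fin.tail x) r = w
      have h := congrArg (freeCone (x 0) (n + 1)) (ih w)
      rw [map_add, map_sub] at h
      rw [freePrism_freeCone, map_sub, freeBoundary_freeCone, freeBoundary_freeCone,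
        freeBoundary_freeCone, freeBoundary_freeCone, map_sub, map_sub, freePrism_freeCone,
        freeMap_freeCone, freeMap_freeBoundary]
      rw [← sub_eq_zero] at h ⊢
      rw [← h]
      abel

end Prism

/-! ### Chain homotopy and functoriality of uniformly finite homology -/

section Homotopy

variable {X : Type*} {Y : Type*} [MetricSpace X] [MetricSpace Y]

theorem isTame_prismMap {φ : X → X} {C : ℝ} (hφ : ∀ x, dist (φ x) x ≤ C) {n : ℕ} (i : Fin n) :
    IsTame (prismMap φ i) := by
  refine ⟨_, .id, |C|, abs_nonneg C, fun x k => ⟨i.predAbove k, ?_⟩⟩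
  unfold prismMap
  split_ifs
  · simp
  · exact (hφ _).trans (le_abs_self C)

/-- The prism operator on uniformly finite chains. -/
def ufPrism {φ : X → X} {C : ℝ} (hφ : ∀ x, dist (φ x) x ≤ C) (n : ℕ) :
    ufChains X n →ₗ[ℝ] ufChains X (n + 1) :=
  ∑ i : Fin (n + 1), (-1 : ℝ) ^ (i : ℕ) • (isTame_prismMap hφ i).pushChain

theorem ufBoundary_pushChain {f : X → Y} (hf : IsQuasiEmbedding f) (n : ℕ)
    (c : ufChains X (n + 1)) : ufBoundary Y n ((hf.isTame (n + 2)).pushChain c) =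
      (hf.isTame (n + 1)).pushChain (ufBoundary X n c) := by
  simp only [ufBoundary, LinearMap.sum_apply, LinearMap.smul_apply, map_sum, map_smul,
    ufFace_eq_pushChain, IsTame.pushChain_pushChain]
  rfl

theorem ufPrism_zero {φ : X → X} {C : ℝ} (hφ : ∀ x, dist (φ x) x ≤ C) (hq : IsQuasiEmbedding φ)
    (c : ufChains X 0) : ufBoundary X 0 (ufPrism hφ 0 c) = (hq.isTame 1).pushChain c - c := by
  simp only [ufBoundary, ufPrism, LinearMap.sum_apply, LinearMap.smul_apply, map_sum, map_smul,
    ufFace_eq_pushChain, IsTame.pushChain_pushChain]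
  ext y
  have h := sum_push_eq_zero (ι := (Fin 1 × Fin 2) ⊕ Unit ⊕ Unit)
    (Sum.elim (fun ij => (-1) ^ (ij.1 : ℕ) * (-1) ^ (ij.2 : ℕ))
      (Sum.elim (fun _ => -1) (fun _ => 1)))
    (Sum.elim (fun ij x => ij.2.removeNth (prismMap φ ij.1 x))
      (Sum.elim (fun _ x k => φ (x k)) (fun _ x => x))) c.1 ?_ ?_ y
  · simp only [Fintype.sum_sum_type, Sum.elim_inl, Sum.elim_inr, Fintype.sum_prod_type,
      Finset.univ_unique (α := Unit), Finset.sum_singleton, push_id] at h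
    simp only [Submodule.coe_sub, Submodule.coe_sum, Submodule.coe_smul,
      Pi.sub_apply, Finset.sum_apply, Pi.smul_apply, IsTame.pushChain_apply,
      smul_eq_mul, Finset.mul_sum]
    simp only [← mul_assoc]
    linarith
  · rintro (⟨i, j⟩ | _ | _) y
    · exact ((isTame_removeNth j).comp (isTame_prismMap hφ i)).finite_fiber c.2 y
    · exact (hq.isTame 1).finite_fiber c.2 y
    · exact (isTame_id 1).finite_fiber c.2 y
  · intro x
    have h := freePrism_homotopy φ 0 (Finsupp.single x 1)
    simp only [freePrism_single, freeBoundary_single, freeMap_single, map_sum, map_smul,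
      Finset.smul_sum, smul_smul] at h
    simp only [Fintype.sum_sum_type, Sum.elim_inl, Sum.elim_inr, Fintype.sum_prod_type,
      Finset.univ_unique (α := Unit), Finset.sum_singleton]
    simp only [Finset.univ_eq_empty (α := Fin 0), Finset.sum_empty, Finset.sum_const_zero,
      add_zero] at h
    rw [h]
    simp

theorem ufPrism_succ {φ : X → X} {C : ℝ} (hφ : ∀ x, dist (φ x) x ≤ C) (hq : IsQuasiEmbedding φ)
    (n : ℕ) (c : ufChains X (n + 1)) :
    ufBoundary X (n + 1) (ufPrism hφ (n + 1) c) + ufPrism hφ n (ufBoundary X n c) =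
      (hq.isTame (n + 2)).pushChain c - c := by
  simp only [ufBoundary, ufPrism, LinearMap.sum_apply, LinearMap.smul_apply, map_sum, map_smul,
    ufFace_eq_pushChain, IsTame.pushChain_pushChain]
  ext y
  -- The summands of the index type are the terms of the homotopy identity, all on one side: faces
  -- of prisms, prisms over faces, `φ`, and the identity.
  have h := sum_push_eq_zero
    (ι := (Fin (n + 2) × Fin (n + 3)) ⊕ (Fin (n + 2) × Fin (n + 1)) ⊕ Unit ⊕ Unit)
    (Sum.elim (fun ij => (-1) ^ (ij.1 : ℕ) * (-1) ^ (ij.2 : ℕ))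
      (Sum.elim (fun ij => (-1) ^ (ij.1 : ℕ) * (-1) ^ (ij.2 : ℕ))
      (Sum.elim (fun _ => -1) (fun _ => 1))))
    (Sum.elim (fun ij x => ij.2.removeNth (prismMap φ ij.1 x))
      (Sum.elim (fun ij x => prismMap φ ij.2 (ij.1.removeNth x))
      (Sum.elim (fun _ x k => φ (x k)) (fun _ x => x)))) c.1 ?_ ?_ y
  · simp only [Fintype.sum_sum_type, Sum.elim_inl, Sum.elim_inr, Fintype.sum_prod_type,
      Finset.univ_unique (α := Unit), Finset.sum_singleton, push_id] at h
    simp only [Submodule.coe_add, Submodule.coe_sub, Submodule.coe_sum, Submodule.coe_smul,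
      Pi.add_apply, Pi.sub_apply, Finset.sum_apply, Pi.smul_apply, IsTame.pushChain_apply,
      smul_eq_mul, Finset.mul_sum]
    simp only [← mul_assoc]
    linarith
  · rintro (⟨i, j⟩ | ⟨i, j⟩ | _ | _) y
    · exact ((isTame_removeNth j).comp (isTame_prismMap hφ i)).finite_fiber c.2 y
    · exact ((isTame_prismMap hφ j).comp (isTame_removeNth i)).finite_fiber c.2 y
    · exact (hq.isTame (n + 2)).finite_fiber c.2 y
    · exact (isTame_id (n + 2)).finite_fiber c.2 y
  · intro x
    have h := freePrism_homotopy φ (n + 1) (Finsupp.single x 1)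
    simp only [freePrism_single, freeBoundary_single, freeMap_single, map_sum, map_smul,
      Finset.smul_sum, smul_smul] at h
    simp only [Fintype.sum_sum_type, Sum.elim_inl, Sum.elim_inr, Fintype.sum_prod_type,
      Finset.univ_unique (α := Unit), Finset.sum_singleton]
    rw [← add_assoc, h]
    simp

theorem IsUfCycle.pushChain {f : X → Y} (hf : IsQuasiEmbedding f) {n : ℕ} {c : ufChains X n}
    (hc : IsUfCycle n c) : IsUfCycle n ((hf.isTame (n + 1)).pushChain c) := by
  cases n with
  | zero => trivial
  | succ n => exact (ufBoundary_pushChain hf n c).trans (by rw [show _ = _ from hc, map_zero])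

/-- A coarse left inverse is enough. If `b` bounds the image of the cycle `c` under `f`, then the
image of `b` under `g` bounds the image of `c` under `g ∘ f`, which differs from `c` by the boundary
of a prism. -/
theorem IsQuasiEmbedding.nontrivial_ufHomology {f : X → Y} {g : Y → X} (hf : IsQuasiEmbedding f)
    (hg : IsQuasiEmbedding g) {C : ℝ} (hgf : ∀ x, dist (g (f x)) x ≤ C) {n : ℕ}
    (h : Nontrivial (ufHomology X n)) : Nontrivial (ufHomology Y n) := by
  rw [nontrivial_ufHomology_iff] at h ⊢
  obtain ⟨c, hc, hc'⟩ := h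
  refine ⟨_, hc.pushChain hf, ?_⟩
  rintro ⟨b, hb⟩
  have h1 : ufBoundary X n ((hg.isTame (n + 2)).pushChain b) =
      ((hg.comp hf).isTame (n + 1)).pushChain c := by
    rw [ufBoundary_pushChain hg, hb, IsTame.pushChain_pushChain (hg.isTame _)]
  have h2 : ufBoundary X n (ufPrism hgf n c) = ((hg.comp hf).isTame (n + 1)).pushChain c - c := by
    cases n with
    | zero => exact ufPrism_zero hgf (hg.comp hf) c
    | succ n =>
      rw [← ufPrism_succ hgf (hg.comp hf), show ufBoundary X n c = 0 from hc, map_zero, add_zero]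
  refine hc' ⟨(hg.isTame (n + 2)).pushChain b - ufPrism hgf n c, ?_⟩
  rw [map_sub, h1, h2, sub_sub_cancel]

end Homotopy

/-! ### Quasi-isometry invariance of the dimension -/

section Dimension

variable {X : Type u} {Y : Type v} [MetricSpace X] [MetricSpace Y]

theorem IsQuasiIsometry.isQuasiEmbedding {f : X → Y} (hf : IsQuasiIsometry f) :
    IsQuasiEmbedding f := by
  obtain ⟨L, C, hL, hC, h, -⟩ := hf
  exact ⟨L, C, hL, hC, h⟩

theorem IsQuasiIsometry.exists_inverse {f : X → Y} (hf : IsQuasiIsometry f) :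
    ∃ g : Y → X, IsQuasiEmbedding g ∧ ∃ C : ℝ, (∀ x, dist (g (f x)) x ≤ C) ∧
      ∀ y, dist (f (g y)) y ≤ C := by
  obtain ⟨L, C, hL, hC, h, hd⟩ := hf
  choose g hg using hd
  have hL0 : 0 < L := by linarith
  have hinv : L⁻¹ ≤ 1 := inv_le_one_of_one_le₀ hL
  -- Since `f (g y)` is within `C` of `y`, distances change by at most `2 * C`, and the additive
  -- error of `f` makes this `3 * C`. For `g (f x)` and `x`, one error from density and one from `f`
  -- give `2 * C` before multiplication by `L`.
  refine ⟨g, ⟨L, L * (3 * C) + 3 * C, hL, by positivity, fun y y' => ?_⟩, L * (2 * C) + C,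
    fun x => ?_, fun y => (hg y).trans (by nlinarith)⟩
  · have a1 := dist_triangle4 y (f (g y)) (f (g y')) y'
    have a2 := dist_triangle4 (f (g y)) y y' (f (g y'))
    have a3 := hg y
    have a4 := hg y'
    rw [dist_comm] at a3
    rw [dist_comm (f (g y)) y, dist_comm y' (f (g y'))] at a2
    obtain ⟨h1, h2⟩ := h (g y) (g y')
    constructor
    · have h3 : L⁻¹ * dist y y' ≤ L⁻¹ * (L * dist (g y) (g y') + 3 * C) := by gcongr; linarith
      rw [mul_add, inv_mul_cancel_left₀ hL0.ne'] at h3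
      have h4 : L⁻¹ * (3 * C) ≤ 1 * (3 * C) := by gcongr
      have h5 : 0 ≤ L * (3 * C) := by positivity
      linarith
    · have h3 : L⁻¹ * dist (g y) (g y') ≤ dist y y' + 3 * C := by linarith
      rw [inv_mul_le_iff₀ hL0] at h3
      linarith
  · have h1 := (h (g (f x)) x).1
    have h2 := hg (f x)
    have h3 : L⁻¹ * dist (g (f x)) x ≤ 2 * C := by linarith
    rw [inv_mul_le_iff₀ hL0] at h3
    linarith

/-- The uniformly finite homological dimension is a quasi-isometry invariant. -/
theorem IsQuasiIsometry.ufHomologicalDimension_eq {f : X → Y} (hf : IsQuasiIsometry f) :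
    ufHomologicalDimension X = ufHomologicalDimension Y := by
  obtain ⟨g, hg, C, hgf, hfg⟩ := hf.exists_inverse
  unfold ufHomologicalDimension
  refine iSup_congr fun n => iSup_congr_Prop ⟨?_, ?_⟩ fun _ => rfl
  · exact hf.isQuasiEmbedding.nontrivial_ufHomology hg hgf
  · exact hg.nontrivial_ufHomology hf.isQuasiEmbedding hfg

end Dimension

/-! ### Finite-index subgroups are quasi-isometric to the group -/

section WordMetricMaps

variable {G : Type u} [Group G] {N : Type v} [Group N]

theorem wordDist_eq_one_left (S : Set G) (g h : G) : wordDist S g h = wordDist S 1 (g⁻¹ * h) := by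
  simp [wordDist]

theorem exists_wordDist_le (S : Set G) {F : Set G} (hF : F.Finite) :
    ∃ B : ℕ, ∀ g h, g⁻¹ * h ∈ F → wordDist S g h ≤ B := by
  obtain ⟨B, hB⟩ := (hF.image (wordDist S 1)).bddAbove
  refine ⟨B, fun g h hgh => ?_⟩
  rw [wordDist_eq_one_left]
  exact hB ⟨_, hgh, rfl⟩

/-- A Lipschitz bound need only be checked on edges of the Cayley graph: follow a shortest word. -/
theorem dist_le_mul_wordDist {Z : Type*} [MetricSpace Z] (S : Set G)
    (hS : Subgroup.closure S = ⊤) (f : G → Z) (L : ℝ)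
    (h : ∀ g s, s ∈ S ∨ s⁻¹ ∈ S → dist (f g) (f (g * s)) ≤ L) (g g' : G) :
    dist (f g) (f g') ≤ L * wordDist S g g' := by
  obtain ⟨l, hlen, hl, hp⟩ := exists_word S hS g g'
  rw [← hlen]
  obtain rfl : g' = g * l.prod := by rw [← hp]; group
  clear hlen hp
  induction l generalizing g with
  | nil => simp
  | cons s l ih =>
    have h1 := h g s (hl s (by simp))
    have h2 := ih (g * s) fun t ht => hl t (by simp [ht])
    rw [List.prod_cons, List.length_cons, ← mul_assoc]
    push_cast
    linarith [dist_triangle (f g) (f (g * s)) (f (g * s * l.prod))]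

theorem exists_finite_transversal (H : Subgroup G) [H.FiniteIndex] :
    ∃ T : Set G, T.Finite ∧ ∀ g, ∃ h ∈ H, ∃ t ∈ T, g = h * t := by
  -- Representatives of left cosets are inverted to represent cosets of the form `H t`.
  refine ⟨Set.range fun q : G ⧸ H => (q.out)⁻¹, Set.finite_range _, fun g => ?_⟩
  refine ⟨g * ((g⁻¹ : G) : G ⧸ H).out, ?_, _, ⟨((g⁻¹ : G) : G ⧸ H), rfl⟩, by group⟩
  have h1 := QuotientGroup.out_eq' ((g⁻¹ : G) : G ⧸ H)
  have h2 := QuotientGroup.eq.1 h1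
  have h3 := H.inv_mem h2
  simpa using h3

-- Writing `g = φ (r g) * t g` with `t g` in a finite set gives a coarse retraction `r`. It is
-- Lipschitz because `φ ((r g)⁻¹ * r (g * s)) = t g * s * (t (g * s))⁻¹` takes finitely many values;
-- this is the lower bound for `φ`.
open scoped Pointwise in
theorem isQuasiIsometry_of_injective (φ : N →* G) (hφ : Function.Injective φ)
    [φ.range.FiniteIndex] (T : Set N) (hT : Subgroup.closure T = ⊤) (hTf : T.Finite)
    (S : Set G) (hS : Subgroup.closure S = ⊤) (hSf : S.Finite) :
    @IsQuasiIsometry N G (wordMetric T hT) (wordMetric S hS) φ := by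
  obtain ⟨U, hU, hdec⟩ := exists_finite_transversal φ.range
  have hdec' : ∀ g, ∃ x : N, ∃ t ∈ U, g = φ x * t := by
    intro g
    obtain ⟨_, ⟨x, rfl⟩, t, ht, h⟩ := hdec g
    exact ⟨x, t, ht, h⟩
  choose r t ht hr using hdec'
  obtain ⟨A, hA⟩ := exists_wordDist_le S (F := φ '' T ∪ (φ '' T)⁻¹)
    ((hTf.image φ).union (hTf.image φ).inv)
  obtain ⟨B, hB⟩ := exists_wordDist_le T (F := φ ⁻¹' (U * (S ∪ S⁻¹) * U⁻¹))
    (((hU.mul (hSf.union hSf.inv)).mul hU.inv).preimage hφ.injOn)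
  obtain ⟨C, hC⟩ := exists_wordDist_le T (F := φ ⁻¹' U) (hU.preimage hφ.injOn)
  obtain ⟨D, hD⟩ := exists_wordDist_le S hU
  have hup : ∀ x y, (wordDist S (φ x) (φ y) : ℝ) ≤ A * wordDist T x y := by
    let := wordMetric S hS
    intro x y
    refine dist_le_mul_wordDist T hT (fun x => φ x) A (fun g s hs => ?_) x y
    refine Nat.cast_le.2 (hA _ _ ?_)
    rw [map_mul, inv_mul_cancel_left]
    rcases hs with hs | hs
    · exact Or.inl ⟨s, hs, rfl⟩
    · exact Or.inr ⟨s⁻¹, hs, by simp⟩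
  have hlow : ∀ x y, (wordDist T x y : ℝ) ≤ B * wordDist S (φ x) (φ y) + 2 * C := by
    let := wordMetric T hT
    intro x y
    have h1 : dist (r (φ x)) (r (φ y)) ≤ B * wordDist S (φ x) (φ y) := by
      refine dist_le_mul_wordDist S hS r B (fun g s hs => ?_) _ _
      refine Nat.cast_le.2 (hB _ _ ?_)
      have h2 : φ ((r g)⁻¹ * r (g * s)) = t g * s * (t (g * s))⁻¹ := by
        have e1 : φ (r g) = g * (t g)⁻¹ := eq_mul_inv_of_mul_eq (hr g).symm
        have e2 : φ (r (g * s)) = g * s * (t (g * s))⁻¹ := eq_mul_inv_of_mul_eq (hr _).symm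
        rw [map_mul, map_inv, e1, e2]
        group
      rw [Set.mem_preimage, h2]
      exact Set.mul_mem_mul (Set.mul_mem_mul (ht g) (hs.imp id id)) (Set.inv_mem_inv.2 (ht _))
    have h3 : ∀ x, dist (r (φ x)) x ≤ C := by
      intro x
      refine Nat.cast_le.2 (hC _ _ ?_)
      rw [Set.mem_preimage, map_mul, map_inv]
      nth_rewrite 2 [hr (φ x)]
      rw [inv_mul_cancel_left]
      exact ht _
    change dist x y ≤ _
    have h4 := dist_triangle4 x (r (φ x)) (r (φ y)) y
    have h5 := h3 x
    rw [dist_comm] at h5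
    linarith [h3 y]
  have hA0 : (0 : ℝ) ≤ A := A.cast_nonneg
  have hB0 : (0 : ℝ) ≤ B := B.cast_nonneg
  have hC0 : (0 : ℝ) ≤ C := C.cast_nonneg
  have hD0 : (0 : ℝ) ≤ D := D.cast_nonneg
  refine ⟨A + B + 1, 2 * C + D, by linarith, by positivity, fun x y => ⟨?_, ?_⟩, fun g => ⟨r g, ?_⟩⟩
  · change (A + B + 1 : ℝ)⁻¹ * (wordDist T x y : ℝ) - (2 * C + D) ≤ wordDist S (φ x) (φ y)
    have hL : (0 : ℝ) < A + B + 1 := by positivity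
    have h0 : (0 : ℝ) ≤ wordDist S (φ x) (φ y) := Nat.cast_nonneg _
    rw [sub_le_iff_le_add, inv_mul_le_iff₀ hL]
    have := hlow x y
    nlinarith [mul_nonneg hA0 h0, mul_nonneg (add_nonneg hA0 hB0) hC0,
      mul_nonneg (add_nonneg hA0 hB0) hD0]
  · change (wordDist S (φ x) (φ y) : ℝ) ≤ (A + B + 1) * wordDist T x y + (2 * C + D)
    have h0 : (0 : ℝ) ≤ wordDist T x y := Nat.cast_nonneg _
    have := hup x y
    nlinarith [mul_nonneg hB0 h0]
  · change (wordDist S (φ (r g)) g : ℝ) ≤ 2 * C + D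
    have h1 : wordDist S (φ (r g)) g ≤ D := by
      refine hD _ _ ?_
      nth_rewrite 2 [hr g]
      rw [inv_mul_cancel_left]
      exact ht g
    have h2 : (wordDist S (φ (r g)) g : ℝ) ≤ D := by exact_mod_cast h1
    linarith

end WordMetricMaps

/-! ### The bar complex and its functoriality in the coefficients -/

open Finsupp in
/-- The differential of the bar complex of a representation. -/
def barD {N A : Type} [Group N] [AddCommGroup A] [Module ℝ A] (ρ : Representation ℝ N A) (n : ℕ) :
    ((Fin (n + 1) → N) →₀ A) →ₗ[ℝ] ((Fin n → N) →₀ A) :=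
  lsum (R := ℝ) ℝ fun g => lsingle (fun i => g i.succ) ∘ₗ ρ (g 0)⁻¹ +
    Finset.univ.sum fun j : Fin (n + 1) =>
      (-1 : ℝ) ^ ((j : ℕ) + 1) • lsingle (Fin.contractNth j (· * ·) g)

section BarMap

variable {N A B C : Type} [AddCommGroup A] [Module ℝ A] [AddCommGroup B] [Module ℝ B]
  [AddCommGroup C] [Module ℝ C]

/-- The map of bar complexes induced by a linear map of coefficients. -/
def barMap (N : Type) (φ : A →ₗ[ℝ] B) (n : ℕ) : ((Fin n → N) →₀ A) →ₗ[ℝ] ((Fin n → N) →₀ B) :=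
  Finsupp.mapRange.linearMap φ

theorem barMap_single (φ : A →ₗ[ℝ] B) (n : ℕ) (g : Fin n → N) (a : A) :
    barMap N φ n (.single g a) = .single g (φ a) := by
  simp [barMap]

theorem barMap_barMap (ψ : B →ₗ[ℝ] C) (φ : A →ₗ[ℝ] B)
    (n : ℕ) (z : (Fin n → N) →₀ A) :
    barMap N ψ n (barMap N φ n z) = barMap N (ψ ∘ₗ φ) n z := by
  ext g
  simp [barMap]

theorem barMap_id (n : ℕ) (z : (Fin n → N) →₀ A) : barMap N LinearMap.id n z = z := by
  ext g
  simp [barMap]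

theorem barMap_surjective {φ : A →ₗ[ℝ] B} (hφ : Function.Surjective φ) (n : ℕ) :
    Function.Surjective (barMap N φ n) :=
  Finsupp.mapRange_surjective _ (map_zero φ) hφ

end BarMap

section Bar

variable {N : Type} [Group N] {A B : Type} [AddCommGroup A] [Module ℝ A] [AddCommGroup B]
  [Module ℝ B] (ρ : Representation ℝ N A) (σ : Representation ℝ N B)

theorem barD_single (n : ℕ) (g : Fin (n + 1) → N) (a : A) :
    barD ρ n (.single g a) = .single (fun i => g i.succ) (ρ (g 0)⁻¹ a) +
      ∑ j : Fin (n + 1), (-1 : ℝ) ^ ((j : ℕ) + 1) • .single (Fin.contractNth j (· * ·) g) a := by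
  simp [barD]

/-- `barD` unfolds to the differential of inhomogeneous chains in group homology, whose square is
zero. -/
theorem barD_barD (n : ℕ) (z : (Fin (n + 2) → N) →₀ A) : barD ρ n (barD ρ (n + 1) z) = 0 := by
  have h := groupHomology.inhomogeneousChains.d_comp_d (A := Rep.of ρ) (n := n)
  exact congrArg (fun f => f.hom z) h

/-- The cycles of the bar complex. -/
def IsBarCycle : ∀ n, ((Fin n → N) →₀ A) → Prop
  | 0, _ => True
  | n + 1, z => barD ρ n z = 0

variable {ρ σ}

theorem barD_barMap {φ : A →ₗ[ℝ] B} (hφ : ∀ g a, φ (ρ g a) = σ g (φ a)) (n : ℕ)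
    (z : (Fin (n + 1) → N) →₀ A) :
    barD σ n (barMap N φ (n + 1) z) = barMap N φ n (barD ρ n z) := by
  induction z using Finsupp.induction_linear with
  | zero => simp
  | add f g hf hg => simp only [map_add, hf, hg]
  | single g a => simp only [barMap_single, barD_single, map_add, map_sum, map_smul, hφ]

theorem IsBarCycle.barMap {φ : A →ₗ[ℝ] B} (hφ : ∀ g a, φ (ρ g a) = σ g (φ a)) {n : ℕ}
    {z : (Fin n → N) →₀ A} (hz : IsBarCycle ρ n z) : IsBarCycle σ n (barMap N φ n z) := by
  cases n with
  | zero => trivial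
  | succ n => exact (barD_barMap hφ n z).trans (by rw [show _ = _ from hz, map_zero])

end Bar

/-! ### Coefficients in M ⊗ ℝ[Q] and the exact sequence of 1 - t -/

section PermRep

variable {N Q Q' : Type} [Group Q] [Group Q'] {M : Type} [AddCommGroup M] [Module ℝ M]

/-- The right translation of `M ⊗ ℝ[Q]`. -/
def rightMul (M : Type) [AddCommGroup M] [Module ℝ M] (s : Q) : (Q →₀ M) →ₗ[ℝ] (Q →₀ M) :=
  Finsupp.lmapDomain M ℝ (· * s)

theorem rightMul_single (s q : Q) (m : M) :
    rightMul M s (.single q m) = .single (q * s) m := by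
  simp [rightMul, Finsupp.mapDomain_single]

/-- The map `M ⊗ ℝ[Q] → M ⊗ ℝ[Q']` induced by a homomorphism. -/
def permMap (M : Type) [AddCommGroup M] [Module ℝ M] (f : Q →* Q') : (Q →₀ M) →ₗ[ℝ] (Q' →₀ M) :=
  Finsupp.lmapDomain M ℝ f

theorem permMap_single (f : Q →* Q') (q : Q) (m : M) :
    permMap M f (.single q m) = .single (f q) m := by
  simp [permMap, Finsupp.mapDomain_single]

theorem permMap_surjective {f : Q →* Q'} (hf : Function.Surjective f) :
    Function.Surjective (permMap M f) :=
  Finsupp.mapDomain_surjective hf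

/-- The right translation of chains with coefficients in `M ⊗ ℝ[Q]`. -/
def transl (N M : Type) [AddCommGroup M] [Module ℝ M] (s : Q) (n : ℕ) :
    ((Fin n → N) →₀ (Q →₀ M)) →ₗ[ℝ] ((Fin n → N) →₀ (Q →₀ M)) :=
  barMap N (rightMul M s) n

theorem transl_transl (s s' : Q) (n : ℕ) (z : (Fin n → N) →₀ (Q →₀ M)) :
    transl N M s n (transl N M s' n z) = transl N M (s' * s) n z := by
  have h : rightMul M s ∘ₗ rightMul M s' = rightMul M (s' * s) := by
    ext
    simp [rightMul_single, mul_assoc]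
  rw [transl, transl, transl, barMap_barMap, h]

theorem transl_one (n : ℕ) (z : (Fin n → N) →₀ (Q →₀ M)) : transl N M (1 : Q) n z = z := by
  have : rightMul M (1 : Q) = LinearMap.id := by
    ext
    simp [rightMul_single]
  rw [transl, this, barMap_id]

theorem permMap_transl (f : Q →* Q') (s : Q) (n : ℕ) (z : (Fin n → N) →₀ (Q →₀ M)) :
    barMap N (permMap M f) n (transl N M s n z) =
      transl N M (f s) n (barMap N (permMap M f) n z) := by
  have h : permMap M f ∘ₗ rightMul M s = rightMul M (f s) ∘ₗ permMap M f := by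
    ext
    simp [rightMul_single, permMap_single]
  rw [transl, transl, barMap_barMap, barMap_barMap, h]

theorem single_sub_single_mul_zpow_mem (t q : Q) (m : M) (k : ℤ) :
    Finsupp.single q m - Finsupp.single (q * t ^ k) m ∈
      LinearMap.range (LinearMap.id - rightMul M t) := by
  induction k with
  | zero => simp
  | succ k ih =>
    have h : Finsupp.single (q * t ^ (k : ℤ)) m - Finsupp.single (q * t ^ ((k : ℤ) + 1)) m ∈
        LinearMap.range (LinearMap.id - rightMul M t) :=
      ⟨.single (q * t ^ (k : ℤ)) m, by simp [rightMul_single, mul_assoc, zpow_add_one]⟩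
    simpa using add_mem ih h
  | pred k ih =>
    have h : Finsupp.single (q * t ^ (-(k : ℤ) - 1)) m - Finsupp.single (q * t ^ (-(k : ℤ))) m ∈
        LinearMap.range (LinearMap.id - rightMul M t) :=
      ⟨.single (q * t ^ (-(k : ℤ) - 1)) m, by
        simp [rightMul_single, mul_assoc, zpow_sub_one]⟩
    simpa using sub_mem ih h

/-- Exactness in the middle. A set-theoretic section of `f` sends `f q` to `q * t ^ k` for some `k`,
and telescoping puts the difference of the two point masses in the image of 1 - t. -/
theorem exists_eq_sub_transl {f : Q →* Q'} (hf : Function.Surjective f) {t : Q}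
    (ht : f.ker = Subgroup.zpowers t) (n : ℕ) (z : (Fin n → N) →₀ (Q →₀ M))
    (hz : barMap N (permMap M f) n z = 0) : ∃ u, z = u - transl N M t n u := by
  let S : (Q' →₀ M) →ₗ[ℝ] (Q →₀ M) := Finsupp.lmapDomain M ℝ (Function.surjInv hf)
  have h1 : ∀ a : Q →₀ M, a - S (permMap M f a) ∈
      LinearMap.range (LinearMap.id - rightMul M t) := by
    intro a
    induction a using Finsupp.induction_linear with
    | zero => simp
    | add a b ha hb =>
      simp only [map_add, add_sub_add_comm]
      exact add_mem ha hb
    | single q m =>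
      have h2 : q⁻¹ * Function.surjInv hf (f q) ∈ f.ker := by
        rw [MonoidHom.mem_ker, map_mul, map_inv, Function.surjInv_eq hf, inv_mul_cancel]
      rw [ht] at h2
      obtain ⟨k, hk⟩ := h2
      have h3 : Function.surjInv hf (f q) = q * t ^ k := by
        rw [show t ^ k = _ from hk, mul_inv_cancel_left]
      simp only [S, permMap_single, Finsupp.lmapDomain_apply, Finsupp.mapDomain_single, h3]
      exact single_sub_single_mul_zpow_mem t q m k
  have h2 : ∀ z : (Fin n → N) →₀ (Q →₀ M), z - barMap N S n (barMap N (permMap M f) n z) ∈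
      LinearMap.range (LinearMap.id - transl N M t n) := by
    intro z
    induction z using Finsupp.induction_linear with
    | zero => simp
    | add a b ha hb =>
      simp only [map_add, add_sub_add_comm]
      exact add_mem ha hb
    | single g a =>
      obtain ⟨b, hb⟩ := h1 a
      refine ⟨.single g b, ?_⟩
      simp only [barMap_single, ← Finsupp.single_sub, ← hb, transl, LinearMap.sub_apply,
        LinearMap.id_apply]
  obtain ⟨u, hu⟩ := h2 z
  refine ⟨u, ?_⟩
  rw [hz, map_zero, sub_zero] at hu
  exact hu.symm

/-- Injectivity of 1 - t: an invariant support is a union of infinite orbits of `t`, so a finite one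
is empty. -/
theorem eq_zero_of_transl_eq {t : Q} (ht : orderOf t = 0) {n : ℕ} {z : (Fin n → N) →₀ (Q →₀ M)}
    (hz : transl N M t n z = z) : z = 0 := by
  ext g q
  by_contra hne
  have h0 : ∀ x, z g (x * t) = z g x := by
    intro x
    conv_lhs => rw [← hz]
    change Finsupp.mapDomain (· * t) (z g) (x * t) = _
    exact Finsupp.mapDomain_apply (mul_left_injective t) _ _
  have h1 : ∀ k : ℕ, z g (q * t ^ k) = z g q := by
    intro k
    induction k with
    | zero => simp
    | succ k ih => rw [pow_succ, ← mul_assoc, h0, ih]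
  have hinj : Function.Injective fun k : ℕ => q * t ^ k :=
    (mul_right_injective q).comp (injective_pow_iff_not_isOfFinOrder.2 (orderOf_eq_zero_iff.1 ht))
  refine Set.infinite_range_of_injective hinj ((z g).support.finite_toSet.subset ?_)
  rintro _ ⟨k, rfl⟩
  simpa [h1] using hne

variable [Group N]

/-- The representation `M ⊗ ℝ[Q]` of `N` with the diagonal action, for a homomorphism `N → Q`. -/
def permRep (ρ : Representation ℝ N M) (π : N →* Q) : Representation ℝ N (Q →₀ M) where
  toFun g := Finsupp.lmapDomain M ℝ (π g * ·) ∘ₗ Finsupp.mapRange.linearMap (ρ g)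
  map_one' := by
    ext
    simp
  map_mul' g h := by
    ext
    simp [Finsupp.mapDomain_single, mul_assoc]

theorem permRep_single (ρ : Representation ℝ N M) (π : N →* Q) (g : N) (q : Q) (m : M) :
    permRep ρ π g (.single q m) = .single (π g * q) (ρ g m) := by
  simp [permRep, Finsupp.mapDomain_single]

theorem rightMul_equivariant (ρ : Representation ℝ N M) (π : N →* Q) (s : Q) (g : N)
    (a : Q →₀ M) : rightMul M s (permRep ρ π g a) = permRep ρ π g (rightMul M s a) := by
  induction a using Finsupp.induction_linear with
  | zero => simp
  | add f g hf hg => simp only [map_add, hf, hg]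
  | single q m => simp only [rightMul_single, permRep_single, mul_assoc]

theorem permMap_equivariant (ρ : Representation ℝ N M) {π : N →* Q} {π' : N →* Q'} {f : Q →* Q'}
    (hf : ∀ g, f (π g) = π' g) (g : N) (a : Q →₀ M) :
    permMap M f (permRep ρ π g a) = permRep ρ π' g (permMap M f a) := by
  induction a using Finsupp.induction_linear with
  | zero => simp
  | add f g hf hg => simp only [map_add, hf, hg]
  | single q m => simp only [permMap_single, permRep_single, map_mul, hf]

theorem barD_transl (ρ : Representation ℝ N M) (π : N →* Q) (s : Q) (n : ℕ)
    (z : (Fin (n + 1) → N) →₀ (Q →₀ M)) :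
    barD (permRep ρ π) n (transl N M s (n + 1) z) = transl N M s n (barD (permRep ρ π) n z) :=
  barD_barMap (rightMul_equivariant ρ π s) n z

end PermRep

/-! ### Homological dimension under cyclic extensions -/

section Dimension

variable {N Q Q' : Type} [Group N] [Group Q] [Group Q']

/-- The kernel of `π : N → Q` has homological dimension at most `h` and nonzero homology with
trivial real coefficients in degree `h`, detected by a class invariant under `Q`. This is expressed
by means of the homology of `N` with coefficients in `M ⊗ ℝ[Q]`. -/
structure KerHasDimension (π : N →* Q) (h : ℕ) : Prop where
  acyclic : ∀ (M : Type) [AddCommGroup M] [Module ℝ M] (ρ : Representation ℝ N M) (n : ℕ), h ≤ n →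
    ∀ z : (Fin (n + 1) → N) →₀ (Q →₀ M), barD (permRep ρ π) n z = 0 →
      ∃ w, barD (permRep ρ π) (n + 1) w = z
  top : ∃ v : (Fin h → N) →₀ (Q →₀ ℝ), IsBarCycle (permRep (1 : Representation ℝ N ℝ) π) h v ∧
    (¬∃ w, barD (permRep (1 : Representation ℝ N ℝ) π) h w = v) ∧
    ∀ s, ∃ w, barD (permRep (1 : Representation ℝ N ℝ) π) h w = transl N ℝ s h v - v

/-- The long exact sequence of 1 - t, carried out on chains. Above degree `h + 1` both neighbouring
terms vanish. In degree `h + 1` the connecting map hits the invariant class `v`, on which 1 - t is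
zero. -/
theorem KerHasDimension.succ {π : N →* Q} {π' : N →* Q'} {h : ℕ} (H : KerHasDimension π h)
    {f : Q →* Q'} (hf : Function.Surjective f) (hπ : ∀ g, f (π g) = π' g) {t : Q}
    (ht : f.ker = Subgroup.zpowers t) (htc : ∀ q, q * t = t * q) (hto : orderOf t = 0) :
    KerHasDimension π' (h + 1) := by
  have hft : f t = 1 := by
    rw [← MonoidHom.mem_ker, ht]
    exact Subgroup.mem_zpowers t
  have hfD : ∀ {M : Type} [AddCommGroup M] [Module ℝ M] (ρ : Representation ℝ N M) (n : ℕ) z,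
      barD (permRep ρ π') n (barMap N (permMap M f) (n + 1) z) =
        barMap N (permMap M f) n (barD (permRep ρ π) n z) := fun ρ n z =>
    barD_barMap (permMap_equivariant ρ hπ) n z
  have hsub : ∀ {M : Type} [AddCommGroup M] [Module ℝ M] {n : ℕ} (u : (Fin n → N) →₀ (Q →₀ M)),
      barMap N (permMap M f) n (u - transl N M t n u) = 0 := by
    intro M _ _ n u
    rw [map_sub, permMap_transl, hft, transl_one, sub_self]
  constructor
  · intro M _ _ ρ n hn z hz
    obtain ⟨n, rfl⟩ : ∃ n', n = n' + 1 := ⟨n - 1, by omega⟩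
    obtain ⟨y, rfl⟩ := barMap_surjective (permMap_surjective hf) _ z
    rw [hfD] at hz
    obtain ⟨x, hx⟩ := exists_eq_sub_transl hf ht _ _ hz
    -- `x` represents the image under the connecting map. Its boundary is fixed by `t`, hence zero
    -- by finite support.
    have hdx : barD (permRep ρ π) n x = 0 := by
      refine eq_zero_of_transl_eq hto ?_
      have := congrArg (barD (permRep ρ π) n) hx
      rw [barD_barD, map_sub, barD_transl] at this
      exact (sub_eq_zero.1 this.symm).symm
    obtain ⟨w, rfl⟩ := H.acyclic M ρ n (by omega) x hdx
    obtain ⟨w', hw'⟩ := H.acyclic M ρ (n + 1) (by omega) (y - (w - transl N M t _ w)) (by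
      rw [map_sub, map_sub, barD_transl, hx, sub_self])
    refine ⟨barMap N (permMap M f) _ w', ?_⟩
    rw [hfD, hw', map_sub, hsub, sub_zero]
  · obtain ⟨v, -, hv, hinv⟩ := H.top
    -- By invariance `y` bounds `t v - v`. It becomes a cycle over `Q'`, and the connecting map
    -- takes its class to that of `v` up to sign.
    obtain ⟨y, hy⟩ := hinv t
    have hcyc : barD (permRep (1 : Representation ℝ N ℝ) π') h (barMap N (permMap ℝ f) (h + 1) y)
        = 0 := by
      rw [hfD, hy, ← neg_sub, map_neg, hsub, neg_zero]
    refine ⟨barMap N (permMap ℝ f) (h + 1) y, hcyc, ?_, ?_⟩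
    · rintro ⟨w', hw'⟩
      obtain ⟨w, rfl⟩ := barMap_surjective (permMap_surjective hf) _ w'
      rw [hfD, ← sub_eq_zero, ← map_sub] at hw'
      obtain ⟨x, hx⟩ := exists_eq_sub_transl hf ht _ _ hw'
      have h1 := congrArg (barD (permRep (1 : Representation ℝ N ℝ) π) h) hx
      rw [map_sub, map_sub, barD_barD, barD_transl, hy, zero_sub] at h1
      refine hv ⟨x, (sub_eq_zero.1 (eq_zero_of_transl_eq hto ?_)).symm⟩
      rw [map_sub]
      rw [← sub_eq_zero] at h1 ⊢
      rw [← neg_eq_zero, ← h1]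
      abel
    · intro s'
      obtain ⟨s, rfl⟩ := hf s'
      obtain ⟨u, hu⟩ := hinv s
      -- The correction `u - t u` vanishes over `Q'`. It turns `s y - y` into a cycle over `Q`; the
      -- mixed terms cancel because `t` is central.
      obtain ⟨w, hw⟩ := H.acyclic ℝ 1 h le_rfl
        (transl N ℝ s (h + 1) y - y + (u - transl N ℝ t (h + 1) u)) (by
          simp only [map_add, map_sub, barD_transl, hy, hu, transl_transl, htc s]
          abel)
      refine ⟨barMap N (permMap ℝ f) _ w, ?_⟩
      rw [hfD, hw, map_add, hsub, add_zero, map_sub, permMap_transl]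

/-- Averaging over the powers of `t` is a chain map that kills the kernel of the projection to `Q'`
and does not change images there, so homology over `Q'` is a retract of homology over `Q`. An
invariant class equals its average modulo boundaries and therefore survives. -/
theorem KerHasDimension.of_finite {π : N →* Q} {π' : N →* Q'} {h : ℕ} (H : KerHasDimension π h)
    {f : Q →* Q'} (hf : Function.Surjective f) (hπ : ∀ g, f (π g) = π' g) {t : Q}
    (ht : f.ker = Subgroup.zpowers t) (hto : 0 < orderOf t) : KerHasDimension π' h := by
  have hft : f t = 1 := by
    rw [← MonoidHom.mem_ker, ht]
    exact Subgroup.mem_zpowers t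
  have hfD : ∀ {M : Type} [AddCommGroup M] [Module ℝ M] (ρ : Representation ℝ N M) (n : ℕ) z,
      barD (permRep ρ π') n (barMap N (permMap M f) (n + 1) z) =
        barMap N (permMap M f) n (barD (permRep ρ π) n z) := fun ρ n z =>
    barD_barMap (permMap_equivariant ρ hπ) n z
  let av : ∀ (M : Type) [AddCommGroup M] [Module ℝ M] (n : ℕ),
      ((Fin n → N) →₀ (Q →₀ M)) →ₗ[ℝ] ((Fin n → N) →₀ (Q →₀ M)) := fun M _ _ n =>
    (orderOf t : ℝ)⁻¹ • ∑ i ∈ Finset.range (orderOf t), transl N M (t ^ i) n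
  have hav : ∀ {M : Type} [AddCommGroup M] [Module ℝ M] {n : ℕ} (u : (Fin n → N) →₀ (Q →₀ M)),
      av M n u = (orderOf t : ℝ)⁻¹ • ∑ i ∈ Finset.range (orderOf t), transl N M (t ^ i) n u := by
    intro M _ _ n u
    simp [av]
  have hne : (orderOf t : ℝ) ≠ 0 := by exact_mod_cast hto.ne'
  have hav0 : ∀ {M : Type} [AddCommGroup M] [Module ℝ M] {n : ℕ} (u : (Fin n → N) →₀ (Q →₀ M)),
      barMap N (permMap M f) n u = 0 → av M n u = 0 := by
    intro M _ _ n u hu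
    obtain ⟨x, rfl⟩ := exists_eq_sub_transl hf ht _ _ hu
    rw [hav]
    simp only [map_sub, transl_transl, ← pow_succ']
    rw [Finset.sum_range_sub', pow_orderOf_eq_one, pow_zero, sub_self, smul_zero]
  have hfav : ∀ {M : Type} [AddCommGroup M] [Module ℝ M] {n : ℕ} (u : (Fin n → N) →₀ (Q →₀ M)),
      barMap N (permMap M f) n (av M n u) = barMap N (permMap M f) n u := by
    intro M _ _ n u
    rw [hav]
    simp only [map_smul, map_sum, permMap_transl, map_pow, hft, one_pow, transl_one,
      Finset.sum_const, Finset.card_range]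
    rw [← Nat.cast_smul_eq_nsmul ℝ, smul_smul, inv_mul_cancel₀ hne, one_smul]
  have hDav : ∀ {M : Type} [AddCommGroup M] [Module ℝ M] (ρ : Representation ℝ N M) {n : ℕ}
      (u : (Fin (n + 1) → N) →₀ (Q →₀ M)),
      barD (permRep ρ π) n (av M (n + 1) u) = av M n (barD (permRep ρ π) n u) := by
    intro M _ _ ρ n u
    rw [hav, hav]
    simp only [map_smul, map_sum, barD_transl]
  constructor
  · intro M _ _ ρ n hn z hz
    obtain ⟨y, rfl⟩ := barMap_surjective (permMap_surjective hf) _ z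
    rw [hfD] at hz
    obtain ⟨w, hw⟩ := H.acyclic M ρ n hn (av M _ y) (by rw [hDav, hav0 _ hz])
    exact ⟨barMap N (permMap M f) _ w, by rw [hfD, hw, hfav]⟩
  · obtain ⟨v, hc, hv, hinv⟩ := H.top
    refine ⟨barMap N (permMap ℝ f) h v, hc.barMap (permMap_equivariant 1 hπ), ?_, ?_⟩
    · rintro ⟨w', hw'⟩
      obtain ⟨w, rfl⟩ := barMap_surjective (permMap_surjective hf) _ w'
      rw [hfD, ← sub_eq_zero, ← map_sub] at hw'
      have h1 := hav0 _ hw'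
      rw [map_sub, ← hDav, sub_eq_zero] at h1
      choose u hu using hinv
      have h2 : barD (permRep 1 π) h ((orderOf t : ℝ)⁻¹ • ∑ i ∈ Finset.range (orderOf t), u (t ^ i))
          = av ℝ h v - v := by
        simp only [map_smul, map_sum, hu, Finset.sum_sub_distrib, Finset.sum_const,
          Finset.card_range, smul_sub, hav]
        rw [← Nat.cast_smul_eq_nsmul ℝ, smul_smul, inv_mul_cancel₀ hne, one_smul]
      exact hv ⟨av ℝ _ w - (orderOf t : ℝ)⁻¹ • ∑ i ∈ Finset.range (orderOf t), u (t ^ i), by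
        rw [map_sub, h2, h1, sub_sub_cancel]⟩
    · intro s'
      obtain ⟨s, rfl⟩ := hf s'
      obtain ⟨u, hu⟩ := hinv s
      exact ⟨barMap N (permMap ℝ f) _ u, by rw [hfD, hu, map_sub, permMap_transl]⟩

end Dimension

/-! ### The trivial subgroup -/

section Base

variable {N : Type} [Group N] {M : Type} [AddCommGroup M] [Module ℝ M]

/-- The contracting homotopy of the bar complex with coefficients in `M ⊗ ℝ[N]`. -/
def barContraction (ρ : Representation ℝ N M) (n : ℕ) :
    ((Fin n → N) →₀ (N →₀ M)) →ₗ[ℝ] ((Fin (n + 1) → N) →₀ (N →₀ M)) :=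
  Finsupp.lsum (R := ℝ) ℝ fun g => Finsupp.lsum (R := ℝ) ℝ fun x =>
    Finsupp.lsingle (Fin.cons x⁻¹ g) ∘ₗ Finsupp.lsingle 1 ∘ₗ ρ x⁻¹

theorem barContraction_single (ρ : Representation ℝ N M) (n : ℕ) (g : Fin n → N) (x : N) (m : M) :
    barContraction ρ n (.single g (.single x m)) =
      .single (Fin.cons x⁻¹ g : Fin (n + 1) → N) (.single 1 (ρ x⁻¹ m)) := by
  rw [barContraction, Finsupp.lsum_single, Finsupp.lsum_single]
  rfl

theorem contractNth_zero_cons (n : ℕ) (a : N) (g : Fin (n + 1) → N) :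
    Fin.contractNth 0 (· * ·) (Fin.cons a g : Fin (n + 2) → N) =
      (Fin.cons (a * g 0) (fun i => g i.succ) : Fin (n + 1) → N) := by
  ext k
  cases k using Fin.cases with
  | zero => simp [Fin.contractNth]
  | succ k => simp [Fin.contractNth]

theorem contractNth_succ_cons (n : ℕ) (j : Fin (n + 1)) (a : N) (g : Fin (n + 1) → N) :
    Fin.contractNth j.succ (· * ·) (Fin.cons a g : Fin (n + 2) → N) =
      (Fin.cons a (Fin.contractNth j (· * ·) g) : Fin (n + 1) → N) := by
  ext k
  cases k using Fin.cases with
  | zero => simp [Fin.contractNth]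
  | succ k => simp [Fin.contractNth]

/-- Prepending `x⁻¹` moves the coefficient over `x` to one over 1. The initial face of the new chain
moves it back and restores the chain; the remaining faces cancel against the contraction of its
boundary. -/
theorem barD_barContraction (ρ : Representation ℝ N M) (n : ℕ)
    (z : (Fin (n + 1) → N) →₀ (N →₀ M)) :
    barD (permRep ρ (MonoidHom.id N)) (n + 1) (barContraction ρ (n + 1) z) +
      barContraction ρ n (barD (permRep ρ (MonoidHom.id N)) n z) = z := by
  induction z using Finsupp.induction_linear with
  | zero => simp
  | add f g hf hg =>
    simp only [map_add]
    rw [add_add_add_comm, hf, hg]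
  | single g a =>
    induction a using Finsupp.induction_linear with
    | zero => simp
    | add f g hf hg =>
      simp only [map_add, Finsupp.single_add]
      rw [add_add_add_comm, hf, hg]
    | single x m =>
      have h : ρ (x⁻¹ * g 0) (ρ (g 0)⁻¹ m) = ρ x⁻¹ m := by
        rw [← Module.End.mul_apply, ← map_mul, mul_assoc, mul_inv_cancel, mul_one]
      simp only [barContraction_single, barD_single, permRep_single, map_add, map_sum, map_smul,
        Fin.sum_univ_succ (n := n + 1), contractNth_zero_cons, contractNth_succ_cons,
        MonoidHom.id_apply, Fin.cons_zero, Fin.cons_succ, inv_inv, mul_one, mul_inv_rev,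
        h, ← Module.End.mul_apply, ← map_mul, mul_inv_cancel, map_one, Module.End.one_apply]
      simp [pow_succ]
      abel

theorem kerHasDimension_id : KerHasDimension (MonoidHom.id N) 0 := by
  constructor
  · intro M _ _ ρ n _ z hz
    refine ⟨barContraction ρ _ z, ?_⟩
    have := barD_barContraction ρ n z
    rwa [hz, map_zero, add_zero] at this
  -- The augmentation vanishes on boundaries and is 1 on the point mass at 1, so it detects this
  -- class.
  · let ε : ((Fin 0 → N) →₀ (N →₀ ℝ)) →ₗ[ℝ] ℝ :=
      Finsupp.lsum (R := ℝ) ℝ fun _ => Finsupp.lsum (R := ℝ) ℝ fun _ => LinearMap.id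
    have hε : ∀ g x r, ε (.single g (.single x r)) = r := fun g x r => by
      rw [Finsupp.lsum_single, Finsupp.lsum_single, LinearMap.id_apply]
    have h : ∀ w, ε (barD (permRep (1 : Representation ℝ N ℝ) (MonoidHom.id N)) 0 w) = 0 := by
      intro w
      induction w using Finsupp.induction_linear with
      | zero => simp
      | add f g hf hg => simp only [map_add, hf, hg, add_zero]
      | single g a =>
        induction a using Finsupp.induction_linear with
        | zero => simp
        | add f g hf hg => simp only [map_add, Finsupp.single_add, hf, hg, add_zero]
        | single x r => simp [barD_single, permRep_single, hε]
    refine ⟨.single Fin.elim0 (.single 1 1), trivial, ?_, fun s => ?_⟩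
    · rintro ⟨w, hw⟩
      have := h w
      rw [hw, hε] at this
      exact one_ne_zero this
    -- The edge labelled `s⁻¹` joins the point masses at 1 and `s`.
    · refine ⟨.single (fun _ => s⁻¹) (.single 1 1), ?_⟩
      simp only [barD_single, permRep_single, transl, barMap_single, rightMul_single]
      simp [sub_eq_add_neg, Subsingleton.elim _ (Fin.elim0 : Fin 0 → N)]

end Base

/-! ### The whole group as kernel -/

section Trivial

/-- The sum of the coefficients `M ⊗ ℝ[Q] → M`. -/
def permSum (Q M : Type) [AddCommGroup M] [Module ℝ M] : (Q →₀ M) →ₗ[ℝ] M :=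
  Finsupp.lsum (R := ℝ) ℝ fun _ => LinearMap.id

theorem permSum_single {Q M : Type} [AddCommGroup M] [Module ℝ M] (q : Q) (m : M) : permSum Q M (.single q m) = m := by
  rw [permSum, Finsupp.lsum_single, LinearMap.id_apply]

variable {N Q : Type} [Group N] [Group Q] {M : Type} [AddCommGroup M] [Module ℝ M]

theorem permSum_equivariant (ρ : Representation ℝ N M) (π : N →* Q) (g : N) (a : Q →₀ M) :
    permSum Q M (permRep ρ π g a) = ρ g (permSum Q M a) := by
  induction a using Finsupp.induction_linear with
  | zero => simp
  | add f g hf hg => simp only [map_add, hf, hg]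
  | single q m => simp only [permSum_single, permRep_single]

theorem lsingle_equivariant [Subsingleton Q] (ρ : Representation ℝ N M) (π : N →* Q) (g : N)
    (m : M) : Finsupp.lsingle (R := ℝ) (1 : Q) (ρ g m) =
      permRep ρ π g (Finsupp.lsingle (R := ℝ) (1 : Q) m) := by
  rw [Finsupp.lsingle_apply, Finsupp.lsingle_apply, permRep_single, Subsingleton.elim (π g * 1) 1]

theorem permSum_comp_lsingle : permSum Q M ∘ₗ Finsupp.lsingle (R := ℝ) (1 : Q) = LinearMap.id := by
  ext m
  simp [permSum_single]

theorem lsingle_comp_permSum [Subsingleton Q] :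
    Finsupp.lsingle (R := ℝ) (1 : Q) ∘ₗ permSum Q M = LinearMap.id := by
  ext q m : 2
  simp [permSum_single, Subsingleton.elim q 1]

/-- For trivial `Q` the coefficients M ⊗ ℝ[Q] are M itself, so the vanishing holds for the homology
of `N` with arbitrary coefficients. -/
theorem KerHasDimension.bar_acyclic [Subsingleton Q] {π : N →* Q} {h : ℕ}
    (H : KerHasDimension π h) (ρ : Representation ℝ N M) {n : ℕ} (hn : h ≤ n)
    (z : (Fin (n + 1) → N) →₀ M) (hz : barD ρ n z = 0) : ∃ w, barD ρ (n + 1) w = z := by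
  obtain ⟨w, hw⟩ := H.acyclic M ρ n hn (barMap N (Finsupp.lsingle (R := ℝ) (1 : Q)) _ z) (by
    rw [barD_barMap (lsingle_equivariant ρ π), hz, map_zero])
  refine ⟨barMap N (permSum Q M) _ w, ?_⟩
  rw [barD_barMap (permSum_equivariant ρ π), hw, barMap_barMap, permSum_comp_lsingle, barMap_id]

theorem KerHasDimension.bar_top [Subsingleton Q] {π : N →* Q} {h : ℕ} (H : KerHasDimension π h) :
    ∃ v, IsBarCycle (1 : Representation ℝ N ℝ) h v ∧
      ¬∃ w, barD (1 : Representation ℝ N ℝ) h w = v := by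
  obtain ⟨v, hv, hv', -⟩ := H.top
  refine ⟨_, hv.barMap (permSum_equivariant 1 π), ?_⟩
  rintro ⟨w, hw⟩
  refine hv' ⟨barMap N (Finsupp.lsingle (R := ℝ) (1 : Q)) _ w, ?_⟩
  rw [barD_barMap (lsingle_equivariant 1 π), hw, barMap_barMap, lsingle_comp_permSum, barMap_id]

end Trivial

/-! ### Left exactness of homology in the top degree -/

section LeftExact

variable {N A B C : Type} [Group N] [AddCommGroup A] [Module ℝ A] [AddCommGroup B] [Module ℝ B]
  [AddCommGroup C] [Module ℝ C]

/-- In the top degree, group homology is a left exact functor of the coefficients. -/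
theorem barMap_not_boundary {ρ : Representation ℝ N A} {σ : Representation ℝ N B}
    {τ : Representation ℝ N C} {i : A →ₗ[ℝ] B} {q : B →ₗ[ℝ] C} (hi : ∀ g a, i (ρ g a) = σ g (i a))
    (hq : ∀ g b, q (σ g b) = τ g (q b)) (hinj : Function.Injective i)
    (hex : LinearMap.ker q = LinearMap.range i) (hsurj : Function.Surjective q) {h : ℕ}
    (hC : ∀ z, barD τ h z = 0 → ∃ w, barD τ (h + 1) w = z) {v : (Fin h → N) →₀ A}
    (hv : ¬∃ w, barD ρ h w = v) : ¬∃ w, barD σ h w = barMap N i h v := by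
  have hqi : q ∘ₗ i = 0 := by
    ext a
    exact LinearMap.mem_ker.1 (hex.ge (LinearMap.mem_range_self i a))
  have h0 : ∀ n z, barMap N q n (barMap N i n z) = 0 := by
    intro n z
    rw [barMap_barMap, hqi]
    ext
    simp [barMap]
  rintro ⟨u, hu⟩
  -- Over `C` the chain `u` becomes a cycle, hence a boundary. After lifting the filling to `w`, the
  -- difference of its boundary and `u` comes from a chain `x` over `A`, and `-x` bounds `v`.
  obtain ⟨w', hw'⟩ := hC (barMap N q _ u) (by rw [barD_barMap hq, hu, h0])
  obtain ⟨w, rfl⟩ := barMap_surjective hsurj _ w'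
  rw [barD_barMap hq, ← sub_eq_zero, ← map_sub] at hw'
  have h1 : barD σ (h + 1) w - u ∈ LinearMap.range (barMap N i (h + 1)) := by
    rw [barMap, Finsupp.range_mapRange_linearMap _ (LinearMap.ker_eq_bot.2 hinj), ← hex,
      ← Finsupp.ker_mapRange]
    exact hw'
  obtain ⟨x, hx⟩ := h1
  refine hv ⟨-x, ?_⟩
  have h2 := congrArg (barD σ h) hx
  rw [barD_barMap hi, map_sub, barD_barD, zero_sub, hu, ← map_neg] at h2
  have h3 : Function.Injective (barMap N i h) := Finsupp.mapRange_injective _ (map_zero i) hinj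
  rw [map_neg, h3 h2, neg_neg]

end LeftExact

/-! ### Coefficients in the bounded functions -/

section Bounded

variable (N : Type) [Group N]

/-- The space of bounded functions on a group. -/
def boundedFunctions : Submodule ℝ (N → ℝ) where
  carrier := {φ | ∃ M : ℝ, ∀ x, |φ x| ≤ M}
  zero_mem' := ⟨0, by simp⟩
  add_mem' := by
    rintro a b ⟨M, hM⟩ ⟨M', hM'⟩
    exact ⟨M + M', fun x => (abs_add_le _ _).trans (add_le_add (hM x) (hM' x))⟩
  smul_mem' := by
    rintro t a ⟨M, hM⟩
    refine ⟨|t| * M, fun x => ?_⟩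
    simp only [Pi.smul_apply, smul_eq_mul, abs_mul]
    exact mul_le_mul_of_nonneg_left (hM x) (abs_nonneg t)

/-- The representation on bounded functions given by right translation. -/
def boundedRep : Representation ℝ N (boundedFunctions N) where
  toFun g :=
    { toFun := fun φ => ⟨fun x => φ.1 (x * g), φ.2.imp fun _ h x => h _⟩
      map_add' := fun _ _ => rfl
      map_smul' := fun _ _ => rfl }
  map_one' := by
    ext φ x
    simp
  map_mul' g h := by
    ext φ x
    simp [mul_assoc]

/-- The inclusion of the constant functions. -/
def constBounded : ℝ →ₗ[ℝ] boundedFunctions N where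
  toFun r := ⟨fun _ => r, |r|, fun _ => le_rfl⟩
  map_add' _ _ := rfl
  map_smul' _ _ := rfl

/-- The representation on bounded functions modulo constants. -/
def boundedQuotientRep :
    Representation ℝ N (boundedFunctions N ⧸ LinearMap.range (constBounded N)) where
  toFun g := Submodule.mapQ _ _ (boundedRep N g) (by
    rintro _ ⟨r, rfl⟩
    exact ⟨r, rfl⟩)
  map_one' := by
    ext φ
    simp
  map_mul' g h := by
    ext φ
    simp

variable {N}

/-- The constants form a trivial subrepresentation, and left exactness applies because the quotient
by them is acyclic above degree `h` like any other representation. -/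
theorem KerHasDimension.bounded_top {Q : Type} [Group Q] [Subsingleton Q] {π : N →* Q} {h : ℕ}
    (H : KerHasDimension π h) :
    ∃ v, IsBarCycle (boundedRep N) h v ∧ ¬∃ w, barD (boundedRep N) h w = v := by
  obtain ⟨v, hv, hv'⟩ := H.bar_top
  have hi : ∀ g r, constBounded N ((1 : Representation ℝ N ℝ) g r) =
      boundedRep N g (constBounded N r) := fun g r => rfl
  refine ⟨_, hv.barMap hi, barMap_not_boundary (τ := boundedQuotientRep N)
    (q := Submodule.mkQ _) hi (fun _ _ => rfl) (fun r s h => ?_) (Submodule.ker_mkQ _)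
    (Submodule.mkQ_surjective _) (fun z hz => H.bar_acyclic _ le_rfl z hz) hv'⟩
  exact congrFun (congrArg Subtype.val h) 1

end Bounded

/-! ### Uniformly finite chains as bar chains with bounded coefficients -/

section Comparison

variable {N : Type} [Group N]

/-- The inhomogeneous coordinates of a tuple. -/
def tupleShape {n : ℕ} (x : Fin (n + 1) → N) (i : Fin n) : N := (x i.castSucc)⁻¹ * x i.succ

/-- The tuple with given initial vertex and inhomogeneous coordinates. -/
def tupleOf {n : ℕ} (a : N) (g : Fin n → N) (i : Fin (n + 1)) : N := a * Fin.partialProd g i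

theorem tupleOf_zero {n : ℕ} (a : N) (g : Fin n → N) : tupleOf a g 0 = a := by
  simp [tupleOf]

theorem tupleShape_tupleOf {n : ℕ} (a : N) (g : Fin n → N) : tupleShape (tupleOf a g) = g := by
  ext i
  simp [tupleShape, tupleOf, mul_assoc, Fin.partialProd_right_inv]

theorem tupleOf_tupleShape {n : ℕ} (x : Fin (n + 1) → N) : tupleOf (x 0) (tupleShape x) = x :=
  Fin.partialProd_left_inv x

theorem removeNth_zero_tupleOf {n : ℕ} (a : N) (g : Fin (n + 1) → N) :
    (0 : Fin (n + 2)).removeNth (tupleOf a g) = tupleOf (a * g 0) (fun i => g i.succ) := by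
  ext k
  simp only [Fin.removeNth, Fin.succAbove_zero, tupleOf, Fin.partialProd_succ', mul_assoc]
  rfl

theorem removeNth_succ_tupleOf {n : ℕ} (i : Fin (n + 1)) (a : N) (g : Fin (n + 1) → N) :
    i.succ.removeNth (tupleOf a g) = tupleOf a (Fin.contractNth i (· * ·) g) := by
  ext k
  simp [Fin.removeNth, tupleOf, Fin.partialProd_contractNth]

/-- The function on tuples defined by a chain with coefficients in the bounded functions. -/
def chainFun (n : ℕ) : ((Fin n → N) →₀ boundedFunctions N) →ₗ[ℝ] ((Fin (n + 1) → N) → ℝ) where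
  toFun f x := (f (tupleShape x)).1 (x 0)
  map_add' f g := by
    ext x
    simp
  map_smul' t f := by
    ext x
    simp

theorem chainFun_apply (n : ℕ) (f : (Fin n → N) →₀ boundedFunctions N) (x : Fin (n + 1) → N) :
    chainFun n f x = (f (tupleShape x)).1 (x 0) := rfl

theorem chainFun_single [DecidableEq N] (n : ℕ) (g : Fin n → N) (φ : boundedFunctions N)
    (x : Fin (n + 1) → N) :
    chainFun n (.single g φ) x = if g = tupleShape x then φ.1 (x 0) else 0 := by
  rw [chainFun_apply, Finsupp.single_apply]
  split_ifs <;> rfl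

theorem chainFun_injective (n : ℕ) : Function.Injective (chainFun (N := N) n) := by
  intro f f' h
  ext g x
  have := congrFun h (tupleOf x g)
  rwa [chainFun_apply, chainFun_apply, tupleShape_tupleOf, tupleOf_zero] at this

/-- Shape and initial vertex determine a tuple, and `β` records how the initial vertex changes under
the face. At most one insertion into `y` has shape `g`, and its initial vertex is `β.symm (y 0)`. -/
theorem finsum_chainFun_single [DecidableEq N] {n : ℕ} (j : Fin (n + 2)) (g : Fin (n + 1) → N)
    (g' : Fin n → N) (β : N ≃ N) (h : ∀ a, j.removeNth (tupleOf a g) = tupleOf (β a) g')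
    (φ : boundedFunctions N) (y : Fin (n + 1) → N) :
    ∑ᶠ z : N, chainFun (n + 1) (.single g φ) (Fin.insertNth j z y) =
      if g' = tupleShape y then φ.1 (β.symm (y 0)) else 0 := by
  have key : ∀ z : N, g = tupleShape (Fin.insertNth j z y : Fin (n + 2) → N) →
      (Fin.insertNth j z y : Fin (n + 2) → N) = tupleOf (β.symm (y 0)) g ∧ g' = tupleShape y := by
    intro z hz
    set x : Fin (n + 2) → N := Fin.insertNth j z y with hx
    have h1 : x = tupleOf (x 0) g := by rw [hz, tupleOf_tupleShape]
    have h2 : y = tupleOf (β (x 0)) g' := by rw [← h, ← h1, hx, Fin.removeNth_insertNth]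
    have h3 : y 0 = β (x 0) := by rw [h2, tupleOf_zero]
    refine ⟨?_, by rw [h2, tupleShape_tupleOf]⟩
    rw [h3, Equiv.symm_apply_apply]
    exact h1
  split_ifs with hg
  · have hy : y = j.removeNth (tupleOf (β.symm (y 0)) g) := by
      rw [h, Equiv.apply_symm_apply, hg, tupleOf_tupleShape]
    have hins : (Fin.insertNth j (tupleOf (β.symm (y 0)) g j) y : Fin (n + 2) → N) =
        tupleOf (β.symm (y 0)) g := by
      nth_rewrite 2 [hy]
      exact Fin.insertNth_self_removeNth _ _
    rw [finsum_eq_single _ (tupleOf (β.symm (y 0)) g j), hins, chainFun_single,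
      tupleShape_tupleOf, if_pos rfl, tupleOf_zero]
    intro z hz
    rw [chainFun_single, if_neg]
    intro h0
    refine hz ?_
    rw [← (key z h0).1, Fin.insertNth_apply_same]
  · refine finsum_eq_zero_of_forall_eq_zero fun z => ?_
    rw [chainFun_single, if_neg]
    exact fun h0 => hg (key z h0).2

variable [MetricSpace N]

/-- Tuples of one shape are translates of each other: they share their diameter, and they are
counted by initial vertices in a ball. -/
theorem chainFun_mem (hinv : ∀ g x y : N, dist (g * x) (g * y) = dist x y)
    (hball : ∀ r, (Metric.ball (1 : N) r).Finite) (n : ℕ)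
    (f : (Fin n → N) →₀ boundedFunctions N) : chainFun n f ∈ ufChains N n := by
  classical
  induction f using Finsupp.induction_linear with
  | zero => simp
  | add f g hf hg =>
    rw [map_add]
    exact add_mem hf hg
  | single g φ =>
    obtain ⟨M, hM⟩ := φ.2
    refine ⟨⟨|M|, fun x => ?_⟩, fun r hr => ⟨(hball r).toFinset.card, fun y => ?_⟩,
      1 + ∑ i, ∑ j, dist (Fin.partialProd g i) (Fin.partialProd g j), by positivity, ?_⟩
    · rw [chainFun_single]
      split_ifs
      · exact (hM _).trans (le_abs_self M)
      · simp
    · rw [← (hball r).encard_eq_coe_toFinset_card]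
      refine (Set.encard_le_encard (t := (fun a => tupleOf (y 0 * a) g) '' Metric.ball 1 r) ?_).trans
        (Set.encard_image_le _ _)
      rintro x ⟨hx, hne⟩
      refine ⟨(y 0)⁻¹ * x 0, ?_, ?_⟩
      · rw [Metric.mem_ball, ← hinv (y 0), mul_inv_cancel_left, mul_one]
        exact (dist_le_pi_dist _ _ _).trans_lt hx
      · rw [chainFun_single] at hne
        have hg : g = tupleShape x := by
          by_contra h
          exact hne (if_neg h)
        simp only [mul_inv_cancel_left]
        rw [hg, tupleOf_tupleShape]
    · rintro x ⟨i, j, hij⟩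
      rw [chainFun_single, if_neg]
      rintro rfl
      rw [← tupleOf_tupleShape x] at hij
      simp only [tupleOf, hinv] at hij
      simp only [tupleOf_tupleShape] at hij
      have h1 : dist (Fin.partialProd (tupleShape x) i) (Fin.partialProd (tupleShape x) j) ≤
          ∑ i, ∑ j, dist (Fin.partialProd (tupleShape x) i) (Fin.partialProd (tupleShape x) j) :=
        (Finset.single_le_sum (f := fun j => dist (Fin.partialProd (tupleShape x) i)
          (Fin.partialProd (tupleShape x) j)) (fun _ _ => dist_nonneg) (Finset.mem_univ j)).trans
        (Finset.single_le_sum (f := fun i => ∑ j, dist (Fin.partialProd (tupleShape x) i)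
          (Fin.partialProd (tupleShape x) j)) (fun _ _ => Finset.sum_nonneg fun _ _ => dist_nonneg)
          (Finset.mem_univ i))
      linarith

/-- Translated to start at 1, a tuple in the support has its vertices in a fixed ball. Balls are
finite, so only finitely many shapes occur. -/
theorem exists_chainFun_eq (hinv : ∀ g x y : N, dist (g * x) (g * y) = dist x y)
    (hball : ∀ r, (Metric.ball (1 : N) r).Finite) (n : ℕ) {c : (Fin (n + 1) → N) → ℝ}
    (hc : c ∈ ufChains N n) : ∃ f, chainFun n f = c := by
  obtain ⟨⟨M, hM⟩, -, R, hR, hR'⟩ := hc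
  have hinj : Function.Injective (fun g : Fin n → N => Fin.partialProd g) := by
    intro g g' h
    ext i
    rw [← Fin.partialProd_right_inv g, ← Fin.partialProd_right_inv g']
    simp only at h
    rw [h]
  have hfin : {g : Fin n → N | ∀ i, Fin.partialProd g i ∈ Metric.ball (1 : N) (R + 1)}.Finite :=
    (Set.Finite.pi' fun _ => hball (R + 1)).preimage hinj.injOn
  refine ⟨Finsupp.onFinset hfin.toFinset (fun g => ⟨fun x => c (tupleOf x g), M, fun x => hM _⟩) ?_,
    ?_⟩
  · intro g hg
    rw [Set.Finite.mem_toFinset]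
    intro i
    by_contra h
    refine hg (Subtype.ext (funext fun x => hR' _ ⟨i, 0, ?_⟩))
    simp only [tupleOf, hinv, Fin.partialProd_zero]
    rw [Metric.mem_ball] at h
    linarith
  · ext x
    rw [chainFun_apply]
    simp [tupleOf_tupleShape]

/-- Uniformly finite chains of a group as chains with coefficients in the bounded functions. -/
def toUfChains (hinv : ∀ g x y : N, dist (g * x) (g * y) = dist x y)
    (hball : ∀ r, (Metric.ball (1 : N) r).Finite) (n : ℕ) :
    ((Fin n → N) →₀ boundedFunctions N) ≃ₗ[ℝ] ufChains N n :=
  LinearEquiv.ofBijective ((chainFun n).codRestrict _ (chainFun_mem hinv hball n))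
    ⟨fun _ _ h => chainFun_injective n (congrArg Subtype.val h), fun c =>
      (exists_chainFun_eq hinv hball n c.2).imp fun _ h => Subtype.ext h⟩

/-- Deleting the initial vertex `a` makes `a * g 0` initial, which translates the coefficient
function by `(g 0)⁻¹` on the right. Every other face keeps the initial vertex and contracts the
shape. -/
theorem ufBoundary_toUfChains (hinv : ∀ g x y : N, dist (g * x) (g * y) = dist x y)
    (hball : ∀ r, (Metric.ball (1 : N) r).Finite) (n : ℕ)
    (f : (Fin (n + 1) → N) →₀ boundedFunctions N) :
    ufBoundary N n (toUfChains hinv hball (n + 1) f) =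
      toUfChains hinv hball n (barD (boundedRep N) n f) := by
  classical
  induction f using Finsupp.induction_linear with
  | zero => simp
  | add f g hf hg => simp only [map_add, hf, hg]
  | single g φ =>
    ext y
    have h1 : ∀ j, (ufFace n j (toUfChains hinv hball (n + 1) (.single g φ))).1 y =
        ∑ᶠ z : N, chainFun (n + 1) (.single g φ) (Fin.insertNth j z y) := fun j => rfl
    simp only [ufBoundary, LinearMap.sum_apply, LinearMap.smul_apply, Submodule.coe_sum,
      Submodule.coe_smul, Finset.sum_apply, Pi.smul_apply, h1]
    rw [Fin.sum_univ_succ, finsum_chainFun_single 0 g _ (Equiv.mulRight (g 0))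
      (fun a => removeNth_zero_tupleOf a g)]
    have h2 : ∀ i : Fin (n + 1), ∑ᶠ z : N, chainFun (n + 1) (.single g φ)
        (Fin.insertNth i.succ z y) = chainFun n (.single (Fin.contractNth i (· * ·) g) φ) y := by
      intro i
      rw [finsum_chainFun_single i.succ g _ (Equiv.refl N)
        (fun a => removeNth_succ_tupleOf i a g), chainFun_single]
      rfl
    change _ = chainFun n (barD (boundedRep N) n (.single g φ)) y
    have h3 : chainFun n (.single (fun i => g i.succ) (boundedRep N (g 0)⁻¹ φ)) y =
        if (fun i => g i.succ) = tupleShape y then φ.1 (y 0 * (g 0)⁻¹) else 0 :=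
      chainFun_single _ _ _ _
    simp only [h2, barD_single, map_add, map_sum, map_smul, Pi.add_apply, Finset.sum_apply,
      Pi.smul_apply, h3, Fin.val_zero, pow_zero, one_smul, Fin.val_succ]
    rfl

theorem ufHomologicalDimension_eq (hinv : ∀ g x y : N, dist (g * x) (g * y) = dist x y)
    (hball : ∀ r, (Metric.ball (1 : N) r).Finite) {Q : Type} [Group Q] [Subsingleton Q]
    {π : N →* Q} {h : ℕ} (H : KerHasDimension π h) :
    ufHomologicalDimension N = ((h : ℕ∞) : WithBot ℕ∞) := by
  unfold ufHomologicalDimension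
  refine le_antisymm (iSup₂_le fun n hn => ?_) ?_
  · rw [nontrivial_ufHomology_iff] at hn
    by_contra hlt
    have hlt' : h < n := by
      rw [not_le] at hlt
      exact_mod_cast hlt
    obtain ⟨n, rfl⟩ : ∃ m, n = m + 1 := ⟨n - 1, by omega⟩
    obtain ⟨c, hc, hc'⟩ := hn
    obtain ⟨f, rfl⟩ := (toUfChains hinv hball _).surjective c
    have h1 : ufBoundary N n (toUfChains hinv hball _ f) = 0 := hc
    rw [ufBoundary_toUfChains, LinearEquiv.map_eq_zero_iff] at h1
    obtain ⟨w, rfl⟩ := H.bar_acyclic _ (by omega) f h1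
    exact hc' ⟨toUfChains hinv hball _ w, ufBoundary_toUfChains hinv hball _ w⟩
  · refine le_iSup₂_of_le h ?_ le_rfl
    rw [nontrivial_ufHomology_iff]
    obtain ⟨v, hv, hv'⟩ := H.bounded_top
    refine ⟨toUfChains hinv hball _ v, ?_, ?_⟩
    · cases h with
      | zero => trivial
      | succ h =>
        refine (ufBoundary_toUfChains hinv hball h v).trans ?_
        rw [show barD (boundedRep N) h v = 0 from hv, map_zero]
    · rintro ⟨b, hb⟩
      obtain ⟨w, rfl⟩ := (toUfChains hinv hball _).surjective b
      rw [ufBoundary_toUfChains] at hb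
      exact hv' ⟨w, (toUfChains hinv hball _).injective hb⟩

end Comparison

/-! ### Ranks of abelian groups extended by one generator -/

section Rank

variable {A : Type*} [AddCommGroup A]

theorem finrank_span_singleton_of_torsion {x : A} {k : ℤ} (hk : k ≠ 0) (hx : k • x = 0) :
    Module.finrank ℤ (Submodule.span ℤ {x}) = 0 := by
  rw [Module.finrank_eq_zero_iff]
  rintro ⟨y, hy⟩
  obtain ⟨m, rfl⟩ := Submodule.mem_span_singleton.1 hy
  refine ⟨k, hk, Subtype.ext ?_⟩
  change k • m • x = 0
  rw [smul_comm, hx, smul_zero]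

theorem finrank_span_singleton_of_torsionFree {x : A} (hx : ∀ k : ℤ, k • x = 0 → k = 0) :
    Module.finrank ℤ (Submodule.span ℤ {x}) = 1 := by
  have hinj : Function.Injective (LinearMap.toSpanSingleton ℤ A x) := by
    rw [← LinearMap.ker_eq_bot, LinearMap.ker_eq_bot']
    exact hx
  rw [← LinearMap.range_toSpanSingleton, LinearMap.finrank_range_of_inj hinj, Module.finrank_self]

theorem finrank_sup_span_singleton [Module.Finite ℤ A] (B : Submodule ℤ A) (a : A) :
    Module.finrank ℤ (B ⊔ Submodule.span ℤ {a} : Submodule ℤ A) =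
      Module.finrank ℤ B + Module.finrank ℤ (Submodule.span ℤ {B.mkQ a}) := by
  set C := B ⊔ Submodule.span ℤ {a}
  have hf : Module.Finite ℤ C := Module.Finite.iff_fg.2 (IsNoetherian.noetherian C)
  have h := Submodule.finrank_quotient_add_finrank (LinearMap.ker (B.mkQ.domRestrict C))
  rw [(B.mkQ.domRestrict C).quotKerEquivRange.finrank_eq] at h
  have h1 : LinearMap.range (B.mkQ.domRestrict C) = Submodule.span ℤ {B.mkQ a} := by
    rw [LinearMap.range_domRestrict, Submodule.map_sup, Submodule.map_span, Set.image_singleton,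
      sup_eq_right, Submodule.map_le_iff_le_comap]
    intro b hb
    simp [(Submodule.Quotient.mk_eq_zero B).2 hb]
  have h2 : LinearMap.ker (B.mkQ.domRestrict C) = B.comap C.subtype := by
    rw [LinearMap.ker_domRestrict, Submodule.ker_mkQ]
  rw [h1, h2, (Submodule.comapSubtypeEquivOfLe (le_sup_left : B ≤ C)).finrank_eq] at h
  rw [← h, add_comm]

end Rank

/-! ### Subgroups between consecutive terms of the lower central series -/

section Layers

open scoped commutatorElement

variable {N : Type u} [Group N]

local notation "γ" => Subgroup.lowerCentralSeries (⊤ : Subgroup N)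

theorem commutator_mem_lowerCentralSeries {i : ℕ} {x : N} (hx : x ∈ γ i) (g : N) :
    ⁅x, g⁆ ∈ γ (i + 1) :=
  Subgroup.commutator_mem_commutator hx (Subgroup.mem_top g)

/-- A subgroup between two consecutive terms of the lower central series is normal. -/
theorem normal_of_le_of_le {i : ℕ} {K : Subgroup N} (h1 : γ (i + 1) ≤ K) (h2 : K ≤ γ i) :
    K.Normal := by
  refine ⟨fun n hn g => ?_⟩
  have h3 : ⁅n, g⁆ ∈ K := h1 (commutator_mem_lowerCentralSeries (h2 hn) g)
  have h4 : g * n * g⁻¹ = ⁅n, g⁆⁻¹ * n := by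
    rw [commutatorElement_def]
    group
  rw [h4]
  exact mul_mem (inv_mem h3) hn

/-- The class of an element in a factor of the lower central series. -/
def factorMk {i : ℕ} (x : γ i) : Additive (LowerCentralFactor N i) :=
  Additive.ofMul (QuotientGroup.mk x)

theorem factorMk_mul {i : ℕ} (x y : γ i) : factorMk (x * y) = factorMk x + factorMk y := rfl

theorem factorMk_inv {i : ℕ} (x : γ i) : factorMk x⁻¹ = -factorMk x := rfl

theorem factorMk_zpow {i : ℕ} (x : γ i) (k : ℤ) : factorMk (x ^ k) = k • factorMk x := rfl

theorem factorMk_surjective {i : ℕ} : Function.Surjective (factorMk (N := N) (i := i)) :=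
  QuotientGroup.mk_surjective

theorem factorMk_eq_zero {i : ℕ} (x : γ i) : factorMk x = 0 ↔ (x : N) ∈ γ (i + 1) :=
  (QuotientGroup.eq_one_iff x).trans Subgroup.mem_subgroupOf

/-- The subgroup of `γᵢ` which is the preimage of a subgroup of `γᵢ / γᵢ₊₁`. -/
def layer (i : ℕ) (B : Submodule ℤ (Additive (LowerCentralFactor N i))) : Subgroup N where
  carrier := {n | ∃ h : n ∈ γ i, factorMk ⟨n, h⟩ ∈ B}
  mul_mem' := by
    rintro a b ⟨ha, ha'⟩ ⟨hb, hb'⟩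
    exact ⟨mul_mem ha hb, B.add_mem ha' hb'⟩
  one_mem' := ⟨one_mem _, by
    rw [(factorMk_eq_zero _).2 (one_mem _)]
    exact B.zero_mem⟩
  inv_mem' := by
    rintro a ⟨ha, ha'⟩
    exact ⟨inv_mem ha, B.neg_mem ha'⟩

variable {i : ℕ} {B C : Submodule ℤ (Additive (LowerCentralFactor N i))}

theorem coe_mem_layer (x : γ i) : (x : N) ∈ layer i B ↔ factorMk x ∈ B :=
  ⟨fun ⟨_, h⟩ => h, fun h => ⟨x.2, h⟩⟩

theorem layer_le : layer i B ≤ γ i := fun _ h => h.1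

theorem le_layer : γ (i + 1) ≤ layer i B := by
  intro n hn
  have hn' : n ∈ γ i := Subgroup.lowerCentralSeries_antitone ⊤ i.le_succ hn
  refine ⟨hn', ?_⟩
  rw [(factorMk_eq_zero _).2 hn]
  exact B.zero_mem

theorem layer_normal : (layer i B).Normal := normal_of_le_of_le le_layer layer_le

theorem layer_mono (h : B ≤ C) : layer i B ≤ layer i C := fun _ ⟨h1, h2⟩ => ⟨h1, h h2⟩

theorem layer_top : layer i (⊤ : Submodule ℤ (Additive (LowerCentralFactor N i))) = γ i :=
  le_antisymm layer_le fun _ h => ⟨h, trivial⟩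

theorem layer_bot : layer i (⊥ : Submodule ℤ (Additive (LowerCentralFactor N i))) = γ (i + 1) :=
  le_antisymm (fun _ ⟨_, h⟩ => (factorMk_eq_zero _).1 h) le_layer

theorem mem_layer_sup_span (t : γ i) (x : N) :
    x ∈ layer i (B ⊔ Submodule.span ℤ {factorMk t}) ↔ ∃ k : ℤ, x⁻¹ * (t : N) ^ k ∈ layer i B := by
  constructor
  · rintro ⟨hx, h⟩
    obtain ⟨b, hb, c, hc, hbc⟩ := Submodule.mem_sup.1 h
    obtain ⟨k, rfl⟩ := Submodule.mem_span_singleton.1 hc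
    refine ⟨k, (coe_mem_layer (⟨x, hx⟩⁻¹ * t ^ k)).2 ?_⟩
    rw [factorMk_mul, factorMk_inv, factorMk_zpow, ← hbc, neg_add_rev, neg_add_cancel_comm]
    exact B.neg_mem hb
  · rintro ⟨k, h⟩
    have h1 : (t : N) ^ k ∈ layer i (B ⊔ Submodule.span ℤ {factorMk t}) := by
      refine (coe_mem_layer (t ^ k)).2 (Submodule.mem_sup_right ?_)
      rw [factorMk_zpow]
      exact Submodule.smul_mem _ k (Submodule.mem_span_singleton_self _)
    have h2 := mul_mem h1 (inv_mem (layer_mono le_sup_left h))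
    simpa using h2

/-- If `X` generates γᵢ modulo γᵢ₊₁ and `S` generates `N`, the commutators of `X` with `S` generate
γᵢ₊₁ modulo γᵢ₊₂. Indeed, let `L` be generated by them and γᵢ₊₂: then γᵢ is central modulo `L`, that
is, [γᵢ, N] ≤ `L`. -/
theorem exists_finite_generating_factor (hN : Group.FG N) (i : ℕ) :
    ∃ X : Set (γ i), X.Finite ∧ Submodule.span ℤ (factorMk '' X) = ⊤ := by
  suffices H : ∃ X : Set N, X.Finite ∧ X ⊆ γ i ∧ γ i ≤ Subgroup.closure X ⊔ γ (i + 1) by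
    obtain ⟨X, hX, hXi, h⟩ := H
    refine ⟨Subtype.val ⁻¹' X, hX.preimage Subtype.val_injective.injOn, ?_⟩
    rw [eq_top_iff]
    intro a _
    obtain ⟨x, rfl⟩ := factorMk_surjective a
    rw [← coe_mem_layer]
    refine (h.trans (sup_le ((Subgroup.closure_le _).2 fun y hy => ?_) le_layer)) x.2
    exact ⟨hXi hy, Submodule.subset_span ⟨⟨y, hXi hy⟩, hy, rfl⟩⟩
  obtain ⟨S, hS, hSf⟩ := Group.fg_iff.1 hN
  induction i with
  | zero => exact ⟨S, hSf, fun _ _ => Subgroup.mem_top _, by simp [hS]⟩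
  | succ i ih =>
    obtain ⟨X, hX, hXi, h⟩ := ih
    have hY : Set.image2 (fun x s => ⁅x, s⁆) X S ⊆ γ (i + 1) := by
      rintro _ ⟨x, hx, s, -, rfl⟩
      exact commutator_mem_lowerCentralSeries (hXi hx) s
    refine ⟨Set.image2 (fun x s => ⁅x, s⁆) X S, hX.image2 _ hSf, hY, ?_⟩
    set L := Subgroup.closure (Set.image2 (fun x s => ⁅x, s⁆) X S) ⊔ γ (i + 1 + 1) with hL
    have hLn : L.Normal := normal_of_le_of_le (i := i + 1) le_sup_right
      (sup_le ((Subgroup.closure_le _).2 hY) (Subgroup.lowerCentralSeries_antitone ⊤ (i + 1).le_succ))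
    let Z := (Subgroup.center (N ⧸ L)).comap (QuotientGroup.mk' L)
    have hZ : ∀ x, x ∈ Z ↔ ∀ g, ⁅x, g⁆ ∈ L := by
      intro x
      simp only [Z, Subgroup.mem_comap, Subgroup.mem_center_iff]
      constructor
      · intro hx g
        rw [← QuotientGroup.eq_one_iff, ← QuotientGroup.mk'_apply, map_commutatorElement,
          commutatorElement_eq_one_iff_mul_comm]
        exact (hx _).symm
      · intro hx q
        obtain ⟨g, rfl⟩ := QuotientGroup.mk'_surjective L q
        have := hx g
        rw [← QuotientGroup.eq_one_iff, ← QuotientGroup.mk'_apply, map_commutatorElement,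
          commutatorElement_eq_one_iff_mul_comm] at this
        exact this.symm
    have hle : γ i ≤ Z := by
      refine h.trans (sup_le ((Subgroup.closure_le _).2 fun x hx => ?_) fun x hx => ?_)
      -- The elements commuting with `x` modulo `L` form a subgroup containing the generators `S`,
      -- hence all of `N`.
      · have h1 : (⊤ : Subgroup N) ≤ (Subgroup.centralizer {QuotientGroup.mk' L x}).comap
            (QuotientGroup.mk' L) := by
          rw [← hS, Subgroup.closure_le]
          intro s hs
          simp only [Subgroup.coe_comap, Set.mem_preimage, SetLike.mem_coe,
            Subgroup.mem_centralizer_singleton_iff]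
          have h2 : ⁅x, s⁆ ∈ L :=
            Subgroup.mem_sup_left (Subgroup.subset_closure ⟨x, hx, s, hs, rfl⟩)
          rw [← QuotientGroup.eq_one_iff, ← QuotientGroup.mk'_apply, map_commutatorElement,
            commutatorElement_eq_one_iff_mul_comm] at h2
          exact h2.symm
        simp only [Z, Subgroup.coe_comap, Set.mem_preimage, SetLike.mem_coe,
          Subgroup.mem_center_iff]
        intro q
        obtain ⟨g, rfl⟩ := QuotientGroup.mk'_surjective L q
        have h3 := h1 (Subgroup.mem_top g)
        rw [Subgroup.mem_comap, Subgroup.mem_centralizer_singleton_iff] at h3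
        exact h3
      · exact (hZ x).2 fun g => Subgroup.mem_sup_right (commutator_mem_lowerCentralSeries hx g)
    exact Subgroup.commutator_le.2 fun x hx g _ => (hZ x).1 (hle hx) g

end Layers

/-! ### Climbing the lower central series -/

section Chain

open scoped commutatorElement

variable {N : Type} [Group N]

local notation "γ" => Subgroup.lowerCentralSeries (⊤ : Subgroup N)

/-- A normal subgroup of homological dimension `h`, in the sense of `KerHasDimension`. -/
def SubgroupHasDimension (K : Subgroup N) (h : ℕ) : Prop :=
  ∃ _ : K.Normal, KerHasDimension (QuotientGroup.mk' K) h

theorem subgroupHasDimension_bot : SubgroupHasDimension (⊥ : Subgroup N) 0 := by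
  -- The finite step with `t = 1` only replaces the identity of `N` by the projection to `N ⧸ ⊥`.
  refine ⟨inferInstance, kerHasDimension_id.of_finite (f := QuotientGroup.mk' ⊥) (t := 1)
    (QuotientGroup.mk'_surjective _) (fun _ => rfl) ?_ (by simp)⟩
  rw [QuotientGroup.ker_mk', Subgroup.zpowers_one_eq_bot]

/-- The new layer is the old one extended by the cyclic group that `t` generates in the quotient,
central since commutators with `t` lie in γᵢ₊₁. Infinite order raises both homological dimension and
rank by one; finite order raises neither. -/
theorem SubgroupHasDimension.layer_sup {i : ℕ} [Module.Finite ℤ (Additive (LowerCentralFactor N i))]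
    {B : Submodule ℤ (Additive (LowerCentralFactor N i))} {h : ℕ}
    (H : SubgroupHasDimension (layer i B) (h + Module.finrank ℤ B)) (t : γ i) :
    SubgroupHasDimension (layer i (B ⊔ Submodule.span ℤ {factorMk t}))
      (h + Module.finrank ℤ (B ⊔ Submodule.span ℤ {factorMk t} : Submodule ℤ _)) := by
  obtain ⟨hn, H⟩ := H
  have hn' : (layer i (B ⊔ Submodule.span ℤ {factorMk t})).Normal := layer_normal
  refine ⟨hn', ?_⟩
  let f := QuotientGroup.map (layer i B) (layer i (B ⊔ Submodule.span ℤ {factorMk t}))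
    (MonoidHom.id N) (layer_mono le_sup_left)
  have hf : Function.Surjective f := by
    intro q
    obtain ⟨x, rfl⟩ := QuotientGroup.mk'_surjective _ q
    exact ⟨QuotientGroup.mk' _ x, rfl⟩
  have hker : f.ker = Subgroup.zpowers (QuotientGroup.mk' (layer i B) t) := by
    ext q
    obtain ⟨x, rfl⟩ := QuotientGroup.mk'_surjective _ q
    have h1 : f (QuotientGroup.mk' _ x) = QuotientGroup.mk' _ x := rfl
    rw [MonoidHom.mem_ker, h1, QuotientGroup.mk'_apply, QuotientGroup.eq_one_iff,
      mem_layer_sup_span, Subgroup.mem_zpowers_iff]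
    refine exists_congr fun k => ?_
    rw [← map_zpow, QuotientGroup.mk'_apply, QuotientGroup.mk'_apply, eq_comm, QuotientGroup.eq]
  have hpow : ∀ k : ℤ, (QuotientGroup.mk' (layer i B) t) ^ k = 1 ↔
      k • B.mkQ (factorMk t) = 0 := by
    intro k
    rw [← map_zpow, QuotientGroup.mk'_apply, QuotientGroup.eq_one_iff, ← map_smul,
      Submodule.mkQ_apply, Submodule.Quotient.mk_eq_zero, ← factorMk_zpow, ← coe_mem_layer]
    rfl
  rw [finrank_sup_span_singleton, ← add_assoc]
  rcases Nat.eq_zero_or_pos (orderOf (QuotientGroup.mk' (layer i B) t)) with h0 | h0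
  · rw [finrank_span_singleton_of_torsionFree]
    · refine H.succ hf (fun _ => rfl) hker (fun q => ?_) h0
      obtain ⟨x, rfl⟩ := QuotientGroup.mk'_surjective _ q
      have h1 : ⁅(t : N), x⁆ ∈ layer i B := le_layer (commutator_mem_lowerCentralSeries t.2 x)
      rw [← QuotientGroup.eq_one_iff, ← QuotientGroup.mk'_apply, map_commutatorElement,
        commutatorElement_eq_one_iff_mul_comm] at h1
      exact h1.symm
    · intro k hk
      rw [← hpow, ← orderOf_dvd_iff_zpow_eq_one, h0] at hk
      simpa using hk
  · rw [finrank_span_singleton_of_torsion (k := orderOf (QuotientGroup.mk' (layer i B) t))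
      (by exact_mod_cast h0.ne'), add_zero]
    · exact H.of_finite hf (fun _ => rfl) hker h0
    · rw [← hpow, zpow_natCast, pow_orderOf_eq_one]

theorem SubgroupHasDimension.lowerCentralSeries (hN : Group.FG N) {i h : ℕ}
    (H : SubgroupHasDimension (γ (i + 1)) h) :
    SubgroupHasDimension (γ i) (h + Module.finrank ℤ (Additive (LowerCentralFactor N i))) := by
  obtain ⟨X, hX, hspan⟩ := exists_finite_generating_factor hN i
  have hfin : Module.Finite ℤ (Additive (LowerCentralFactor N i)) :=
    ⟨Submodule.fg_def.2 ⟨_, hX.image _, hspan⟩⟩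
  have key : SubgroupHasDimension (layer i (Submodule.span ℤ (factorMk '' X)))
      (h + Module.finrank ℤ (Submodule.span ℤ (factorMk '' X))) := by
    clear hspan
    induction X, hX using Set.Finite.induction_on with
    | empty =>
      rw [Set.image_empty, Submodule.span_empty, layer_bot, finrank_bot, add_zero]
      exact H
    | insert _ _ ih =>
      rw [Set.image_insert_eq, Submodule.span_insert, sup_comm]
      exact ih.layer_sup _
  rwa [hspan, layer_top, finrank_top] at key

theorem subgroupHasDimension_top (hN : Group.FG N) [Group.IsNilpotent N] :
    SubgroupHasDimension (⊤ : Subgroup N) (nilpotentHirschRank N) := by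
  have key : ∀ i, i ≤ Group.nilpotencyClass N → SubgroupHasDimension (γ i)
      (∑ j ∈ Finset.Ico i (Group.nilpotencyClass N),
        Module.finrank ℤ (Additive (LowerCentralFactor N j))) := by
    intro i hi
    induction hi using Nat.decreasingInduction with
    | self =>
      rw [Finset.Ico_self, Finset.sum_empty, Subgroup.lowerCentralSeries_nilpotencyClass]
      exact subgroupHasDimension_bot
    | of_succ i hi ih =>
      rw [Finset.sum_eq_sum_Ico_succ_bot hi, add_comm]
      exact ih.lowerCentralSeries hN
  have h := key 0 (Nat.zero_le _)
  rwa [← Finset.range_eq_Ico] at h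

end Chain

/-! ### Invariance of the Hirsch rank under isomorphism -/

section Transport

variable {N : Type u} {N' : Type v} [Group N] [Group N']

/-- An isomorphism of groups induces isomorphisms of the factors of the lower central series. -/
def lowerCentralFactorCongr (e : N ≃* N') (i : ℕ) :
    LowerCentralFactor N i ≃* LowerCentralFactor N' i := by
  have h : ∀ i, (Subgroup.lowerCentralSeries (⊤ : Subgroup N) i).map (e : N →* N') =
      Subgroup.lowerCentralSeries (⊤ : Subgroup N') i := fun i => by
    rw [Subgroup.map_lowerCentralSeries, Subgroup.map_top_of_surjective _ e.surjective]
  have hmem : ∀ i x, e x ∈ Subgroup.lowerCentralSeries (⊤ : Subgroup N') i ↔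
      x ∈ Subgroup.lowerCentralSeries (⊤ : Subgroup N) i := fun i x => by
    rw [← h i]
    exact Subgroup.mem_map_iff_mem e.injective
  refine QuotientGroup.congr _ _
    ((e.subgroupMap (Subgroup.lowerCentralSeries (⊤ : Subgroup N) i)).trans
      (MulEquiv.subgroupCongr (h i))) ?_
  ext y
  simp only [Subgroup.mem_map, Subgroup.mem_subgroupOf]
  constructor
  · rintro ⟨x, hx, rfl⟩
    exact (hmem (i + 1) x).2 hx
  · intro hy
    refine ⟨⟨e.symm y, (hmem i _).1 (by simp)⟩, (hmem (i + 1) _).1 (by simpa using hy), ?_⟩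
    ext
    simp

theorem nilpotentHirschRank_congr [Group.IsNilpotent N] [Group.IsNilpotent N'] (e : N ≃* N') :
    nilpotentHirschRank N = nilpotentHirschRank N' := by
  have h : Group.nilpotencyClass N = Group.nilpotencyClass N' :=
    le_antisymm (Group.nilpotencyClass_le_of_surjective e.symm.toMonoidHom e.symm.surjective)
      (Group.nilpotencyClass_le_of_surjective e.toMonoidHom e.surjective)
  unfold nilpotentHirschRank
  rw [h]
  exact Finset.sum_congr rfl fun i _ =>
    (lowerCentralFactorCongr e i).toAdditive.toIntLinearEquiv.finrank_eq

end Transport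

/-! ### From nilpotent to virtually nilpotent groups -/

section WordMetricGroup

variable {G : Type u} [Group G]

theorem wordDist_mul_left (S : Set G) (g x y : G) :
    wordDist S (g * x) (g * y) = wordDist S x y := by
  rw [wordDist_eq_one_left, wordDist_eq_one_left S x y, mul_inv_rev, mul_assoc,
    inv_mul_cancel_left]

theorem finite_wordDist_le (S : Set G) (hS : Subgroup.closure S = ⊤) (hSf : S.Finite) (n : ℕ) :
    {g | wordDist S 1 g ≤ n}.Finite := by
  have hfin : (S ∪ S⁻¹).Finite := hSf.union hSf.inv
  have : Finite (S ∪ S⁻¹ : Set G) := hfin.to_subtype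
  refine ((List.finite_length_le (S ∪ S⁻¹ : Set G) n).image
    fun l => (l.map Subtype.val).prod).subset ?_
  intro g hg
  obtain ⟨l, hlen, hl, hp⟩ := exists_word S hS 1 g
  lift l to List (S ∪ S⁻¹ : Set G) using hl
  rw [List.length_map] at hlen
  refine ⟨l, hlen.trans_le hg, ?_⟩
  exact hp.symm.trans (by rw [inv_one, one_mul])

theorem groupUfHomologicalDimension_of_nilpotent {N : Type} [Group N] [Group.IsNilpotent N]
    (S : Set N) (hS : Subgroup.closure S = ⊤) (hSf : S.Finite) :
    groupUfHomologicalDimension S hS = ((nilpotentHirschRank N : ℕ∞) : WithBot ℕ∞) := by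
  obtain ⟨_, H⟩ := subgroupHasDimension_top (Group.fg_iff.2 ⟨S, hS, hSf⟩)
  have : Subsingleton (N ⧸ (⊤ : Subgroup N)) := QuotientGroup.subsingleton_quotient_top
  let := wordMetric S hS
  refine ufHomologicalDimension_eq (fun g x y => ?_) (fun r => ?_) H
  · exact congrArg Nat.cast (wordDist_mul_left S g x y)
  · refine (finite_wordDist_le S hS hSf ⌈r⌉₊).subset fun g hg => ?_
    rw [Metric.mem_ball, dist_comm] at hg
    have h : (wordDist S 1 g : ℝ) ≤ ⌈r⌉₊ := hg.le.trans (Nat.le_ceil r)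
    exact_mod_cast h

theorem Group.FG.countable (hG : Group.FG G) : Countable G := by
  obtain ⟨α, _, φ, hφ⟩ := Group.fg_iff_exists_freeGroup_hom_surjective_finite.1 hG
  exact hφ.countable

theorem groupUfHomologicalDimension_eq (S : Set G) (hS : Subgroup.closure S = ⊤) (hSf : S.Finite)
    (N : Subgroup G) [Group.IsNilpotent N] (hN : N.FiniteIndex) :
    groupUfHomologicalDimension S hS = ((nilpotentHirschRank N : ℕ∞) : WithBot ℕ∞) := by
  have hG : Group.FG G := Group.fg_iff.2 ⟨S, hS, hSf⟩
  have hNfg : Group.FG N := N.fg_of_index_ne_zero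
  have := hNfg.countable
  -- The bar complexes are set up in the lowest universe; a finitely generated group is countable
  -- and has a copy there.
  let e : Shrink.{0} N ≃* N := Shrink.mulEquiv
  have hnil : Group.IsNilpotent (Shrink.{0} N) := (Group.isNilpotent_congr e).2 inferInstance
  have hfg : Group.FG (Shrink.{0} N) :=
    Group.fg_of_surjective (f := e.symm.toMonoidHom) e.symm.surjective
  obtain ⟨T, hT, hTf⟩ := Group.fg_iff.1 hfg
  let φ : Shrink.{0} N →* G := N.subtype.comp e.toMonoidHom
  have hφ : Function.Injective φ := Subtype.val_injective.comp e.injective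
  have hrange : φ.range = N := by
    rw [MonoidHom.range_comp, MonoidHom.range_eq_top.2 e.surjective, ← MonoidHom.range_eq_map,
      Subgroup.range_subtype]
  have hfi : φ.range.FiniteIndex := by rwa [hrange]
  have hqi := isQuasiIsometry_of_injective φ hφ T hT hTf S hS hSf
  rw [← nilpotentHirschRank_congr e, ← groupUfHomologicalDimension_of_nilpotent T hT hTf]
  exact (@IsQuasiIsometry.ufHomologicalDimension_eq _ _ (wordMetric T hT) (wordMetric S hS) _ hqi).symm

theorem groupUfHomologicalDimension_eq_hirschRank (hG : Group.IsVirtuallyNilpotent G) (S : Set G)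
    (hS : Subgroup.closure S = ⊤) (hSf : S.Finite) :
    groupUfHomologicalDimension S hS = ((hirschRank G : ℕ∞) : WithBot ℕ∞) := by
  have := hG.choose_spec.1
  rw [groupUfHomologicalDimension_eq S hS hSf hG.choose hG.choose_spec.2, hirschRank, dif_pos hG]

end WordMetricGroup
end

/-- For a finitely generated virtually nilpotent group `G`, all nilpotent subgroups of finite index
have the same Hirsch rank (so that the Hirsch rank of `G` is well defined), and it equals the
uniformly finite homological dimension of `G`, for every finite generating set. Quasi-isometric
finitely generated virtually nilpotent groups have the same Hirsch rank. -/
theorem corollary3p5 :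
    (∀ (G : Type u) [Group G], Group.FG G → Group.IsVirtuallyNilpotent G →
      (∀ (N : Subgroup G) [Group.IsNilpotent N], N.FiniteIndex →
        nilpotentHirschRank N = hirschRank G) ∧
      ∀ (S : Set G) (hS : Subgroup.closure S = ⊤), S.Finite →
        ((hirschRank G : ℕ∞) : WithBot ℕ∞) = groupUfHomologicalDimension S hS) ∧
    (∀ (G : Type u) (H : Type v) [Group G] [Group H], Group.FG G → Group.FG H →
      Group.IsVirtuallyNilpotent G → Group.IsVirtuallyNilpotent H →
      GroupsQuasiIsometric G H → hirschRank G = hirschRank H) := by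
  refine ⟨fun G _ hfg hG => ⟨fun N _ hN => ?_, fun S hS hSf => ?_⟩,
    fun G H _ _ _ _ hG hH hqi => ?_⟩
  -- Both ranks equal the dimension for one finite generating set, which does not involve `N`.
  · obtain ⟨S, hS, hSf⟩ := Group.fg_iff.1 hfg
    have h1 := groupUfHomologicalDimension_eq S hS hSf N hN
    rw [groupUfHomologicalDimension_eq_hirschRank hG S hS hSf] at h1
    exact_mod_cast h1.symm
  · exact (groupUfHomologicalDimension_eq_hirschRank hG S hS hSf).symm
  · obtain ⟨S, hS, T, hT, hSf, hTf, f, hf⟩ := hqi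
    have h1 : groupUfHomologicalDimension S hS = groupUfHomologicalDimension T hT :=
      @IsQuasiIsometry.ufHomologicalDimension_eq _ _ (wordMetric S hS) (wordMetric T hT) f hf
    rw [groupUfHomologicalDimension_eq_hirschRank hG S hS hSf,
      groupUfHomologicalDimension_eq_hirschRank hH T hT hTf] at h1
    exact_mod_cast h1
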